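/- Let $(M,g)$ be a compact smooth Riemannian manifold (without boundary, not necessarily connected or orientable) and let $(N,\omega)$ be a symplectic manifold, i.e. a smooth manifold with a smooth, closed, nondegenerate $2$-form $\omega$. For a smooth map $\varphi:M\to N$ let $$F(\varphi)=\frac12\int_M\|\varphi^*\omega\|^2\,d\mathrm{vol}_g ,$$ where $\|\cdot\|$ is the norm on $2$-forms induced by $g$ (so $\|\eta\|^2=\sum_{i<j}\eta(e_i,e_j)^2$ for an orthonormal frame) and $d\mathrm{vol}_g$ is the Riemannian volume measure. A smooth map $\varphi$ is a critical point of $F$ if $\frac{d}{dt}F(\varphi_t)\big|_{t=0}=0$ for every smooth variation $(\varphi_t)_{t\in(-\varepsilon,\varepsilon)}$ of $\varphi=\varphi_0$. Then every critical point of $F$ that is an immersion minimizes $F$ in its homotopy class: if $\varphi:M\to N$ is smooth, $d\varphi_x$ is injective for every $x\in M$, and $\varphi$ is a critical point of $F$, then $F(\varphi)\le F(\psi)$ for every smooth map $\psi:M\to N$ homotopic to $\varphi$. -/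

import Mathlib

open Manifold MeasureTheory Set Bundle
open scoped ContDiff

noncomputable section

section Symplectic

variable {n : ℕ} {N : Type*} [TopologicalSpace N] [ChartedSpace (EuclideanSpace ℝ (Fin n)) N]

/-- The expression of a field `Ω` of alternating `2`-forms on `N` in the chart around `y`: the
pull-back of `Ω` under the inverse of the chart, a `2`-form on (the chart's target in) `ℝⁿ`. -/
def formInChart (Ω : ∀ y : N, TangentSpace (𝓡 n) y [⋀^Fin 2]→L[ℝ] ℝ) (y : N)
    (u : EuclideanSpace ℝ (Fin n)) : EuclideanSpace ℝ (Fin n) [⋀^Fin 2]→L[ℝ] ℝ :=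
  (Ω ((extChartAt (𝓡 n) y).symm u)).compContinuousLinearMap
    (mfderiv 𝓘(ℝ, EuclideanSpace ℝ (Fin n)) (𝓡 n) (extChartAt (𝓡 n) y).symm u)

variable (n N) in
/-- A symplectic form on the `n`-dimensional manifold `N`: a smooth, closed, nondegenerate
`2`-form. Smoothness and closedness are local and are expressed in the charts of `N`. -/
structure SymplecticForm where
  /-- The underlying field of alternating bilinear forms. -/
  form : ∀ y : N, TangentSpace (𝓡 n) y [⋀^Fin 2]→L[ℝ] ℝ
  smooth : ∀ y : N, ContDiffOn ℝ ∞ (formInChart form y) (extChartAt (𝓡 n) y).target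
  closed : ∀ y : N, ∀ u ∈ (extChartAt (𝓡 n) y).target, extDeriv (formInChart form y) u = 0
  nondegenerate : ∀ (y : N) (v : TangentSpace (𝓡 n) y),
    (∀ w : TangentSpace (𝓡 n) y, form y ![v, w] = 0) → v = 0

end Symplectic

section Riemannian

variable {m : ℕ} {M : Type*} [TopologicalSpace M] [ChartedSpace (EuclideanSpace ℝ (Fin m)) M]
  [RiemannianBundle (fun x : M ↦ TangentSpace (𝓡 m) x)]

/-- The squared pointwise norm of a `2`-form `η` on `T_x M`, with respect to the Riemannian metric:
`∑_{i < j} η(e_i, e_j)²` for an orthonormal basis `e` of `T_x M` (it does not depend on `e`). -/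
def formNormSq (x : M) (η : TangentSpace (𝓡 m) x [⋀^Fin 2]→L[ℝ] ℝ) : ℝ :=
  haveI : FiniteDimensional ℝ (TangentSpace (𝓡 m) x) :=
    inferInstanceAs (FiniteDimensional ℝ (EuclideanSpace ℝ (Fin m)))
  let e := stdOrthonormalBasis ℝ (TangentSpace (𝓡 m) x)
  ∑ i, ∑ j ∈ Finset.Ioi i, η ![e i, e j] ^ 2

/-- The coordinate vector field `∂_i` of the chart around `x`, at the point with coordinates `u`. -/
def coordVector (x : M) (u : EuclideanSpace ℝ (Fin m)) (i : Fin m) :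
    TangentSpace (𝓡 m) ((extChartAt (𝓡 m) x).symm u) :=
  mfderiv 𝓘(ℝ, EuclideanSpace ℝ (Fin m)) (𝓡 m) (extChartAt (𝓡 m) x).symm u
    (EuclideanSpace.single i (1 : ℝ))

/-- The Riemannian volume density `√(det (g_ij))` in the chart around `x`, where
`g_ij = g(∂_i, ∂_j)`. -/
def volumeDensity (x : M) (u : EuclideanSpace ℝ (Fin m)) : ℝ :=
  √(Matrix.of fun i j : Fin m ↦ inner ℝ (coordVector x u i) (coordVector x u j)).det

variable (m) in
/-- The Riemannian volume measure on the domain of the chart around `x`: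
`√(det (g_ij)) du₁ ⋯ du_m`, transported to `M` by the inverse of the chart. -/
def chartVolume [MeasurableSpace M] (x : M) : Measure M :=
  ((volume.restrict (extChartAt (𝓡 m) x).target).withDensity
    fun u ↦ ENNReal.ofReal (volumeDensity x u)).map (extChartAt (𝓡 m) x).symm

variable (m M) in
/-- The Riemannian volume measure of `M` (no orientation is needed): the local volume measures
`√(det (g_ij)) du₁ ⋯ du_m` of the charts, glued with a smooth partition of unity subordinate to the
chart domains. By the change of variables formula it does not depend on the partition of unity. -/
def riemannianVolume [IsManifold (𝓡 m) ∞ M] [T2Space M] [SigmaCompactSpace M]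
    [MeasurableSpace M] : Measure M :=
  let ρ : SmoothPartitionOfUnity M (𝓡 m) M :=
    (SmoothPartitionOfUnity.exists_isSubordinate_chartAt_source (𝓡 m) M).choose
  Measure.sum fun x : M ↦ (chartVolume m x).withDensity fun p ↦ ENNReal.ofReal (ρ x p)

end Riemannian

section Energy

variable {m n : ℕ}
  {M : Type*} [TopologicalSpace M] [ChartedSpace (EuclideanSpace ℝ (Fin m)) M]
  [IsManifold (𝓡 m) ∞ M] [T2Space M] [CompactSpace M] [MeasurableSpace M]
  [RiemannianBundle (fun x : M ↦ TangentSpace (𝓡 m) x)]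
  {N : Type*} [TopologicalSpace N] [ChartedSpace (EuclideanSpace ℝ (Fin n)) N]

variable (m) in
/-- The pull-back `(φ^*Ω)_x (v, w) = Ω_{φ(x)} (dφ_x v, dφ_x w)`. -/
def SymplecticForm.pullback (Ω : SymplecticForm n N) (φ : M → N) (x : M) :
    TangentSpace (𝓡 m) x [⋀^Fin 2]→L[ℝ] ℝ :=
  (Ω.form (φ x)).compContinuousLinearMap (mfderiv (𝓡 m) (𝓡 n) φ x)

variable (m) in
/-- The symplectic Dirichlet energy `F(φ) = ½ ∫_M ‖φ^*Ω‖² dvol_g` of a map `φ : M → N`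
(used for smooth `φ`; `M` is compact). -/
def symplecticEnergy (Ω : SymplecticForm n N) (φ : M → N) : ℝ :=
  1 / 2 * ∫ x, formNormSq x (Ω.pullback m φ x) ∂(riemannianVolume m M)

variable (m) in
/-- `φ` is a critical point of `F`: for every smooth variation `φ_t`, `t ∈ (-ε, ε)`, of `φ = φ_0`,
the function `t ↦ F(φ_t)` has derivative `0` at `t = 0`. -/
def IsCriticalPoint (Ω : SymplecticForm n N) (φ : M → N) : Prop :=
  ∀ (ε : ℝ) (Φ : ℝ → M → N), 0 < ε →
    ContMDiffOn (𝓘(ℝ, ℝ).prod (𝓡 m)) (𝓡 n) ∞ (fun p : ℝ × M ↦ Φ p.1 p.2)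
      (Ioo (-ε) ε ×ˢ univ) →
    Φ 0 = φ →
    HasDerivAt (fun t ↦ symplecticEnergy m Ω (Φ t)) 0 0

end Energy

end

/-! Write `I(f) = ∫ ⟨φ^*ω, f^*ω⟩`. The theorem follows once `I` is known to be constant on the
homotopy class of `φ`: then `2F(φ) = I(φ) = I(ψ) ≤ F(φ) + F(ψ)`, the last step being `2⟨a, b⟩ ≤ ‖a‖²
+ ‖b‖²` integrated over `M` (`integral_formInner_le`).

Infinitesimally, if `f` moves with velocity `V`, closedness of `ω` makes the derivative of `f^*ω`
exact, equal to `dα` with `α = ω(V, df ·)` (`pullFormVar_eq`). Since `ω` is nondegenerate and `φ` is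
an immersion, the map sending a field `W` along `φ` to the 1-form `ω(W, dφ ·)` is onto, so `α = ω(W,
dφ ·)` for some `W` (`exists_variation_contractForm_eq`). Hence `dα` is also the derivative of
`φ_s^*ω` for a variation of `φ` itself, and criticality gives `∫ ⟨φ^*ω, dα⟩ = 0`
(`integral_varyPairing_eq_zero`). In other words `φ^*ω` is coclosed, but neither the codifferential
nor Stokes' theorem is needed.

All variations used are straight-line motions `vary` supported in one chart of `M` and one chart of
`N`, which gives `integral_formInner_vary_one`. Passing to an arbitrary continuous homotopy is
topological: two smooth maps uniformly close to the same continuous map are joined by finitely many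
such motions (`InvariantUnderVary.exists_eq_of_dist_lt`), and smooth approximations of the stages of
the homotopy then give a locally constant value of `I` on the unit interval
(`InvariantUnderVary.eq_of_homotopic`). -/

noncomputable section

/-! ### The inner product of 2-forms in coordinates, and finiteness of the volume -/

section Metric

open Matrix

variable {m : ℕ} {M : Type*} [TopologicalSpace M] [ChartedSpace (EuclideanSpace ℝ (Fin m)) M]

/-- The coordinate frame of the chart around `x₀`, as a map `ℝᵐ → T_x M`. -/
def chartFrame (x₀ x : M) : EuclideanSpace ℝ (Fin m) →L[ℝ] TangentSpace (𝓡 m) x :=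
  mfderiv 𝓘(ℝ, EuclideanSpace ℝ (Fin m)) (𝓡 m) (extChartAt (𝓡 m) x₀).symm (extChartAt (𝓡 m) x₀ x)

/-- Identifying the coordinate frame with the inverse of the tangent bundle trivialization makes its
bijectivity and continuity available from bundle theory. -/
theorem chartFrame_eq_symmL [IsManifold (𝓡 m) ∞ M] {x₀ x : M}
    (hx : x ∈ (extChartAt (𝓡 m) x₀).source) :
    chartFrame x₀ x =
      (trivializationAt (EuclideanSpace ℝ (Fin m)) (TangentSpace (𝓡 m)) x₀).symmL ℝ x := by
  rw [extChartAt_source] at hx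
  have : IsManifold (𝓡 m) 1 M := .of_le (n := ∞) (by simp)
  rw [TangentBundle.symmL_trivializationAt hx]
  simp only [modelWithCornersSelf_coe, range_id]
  rw [mfderivWithin_univ]
  rfl

theorem chartFrame_bijective [IsManifold (𝓡 m) ∞ M] {x₀ x : M}
    (hx : x ∈ (extChartAt (𝓡 m) x₀).source) : Function.Bijective (chartFrame (m := m) x₀ x) := by
  rw [chartFrame_eq_symmL hx]
  rw [extChartAt_source] at hx
  set e := trivializationAt (EuclideanSpace ℝ (Fin m)) (TangentSpace (𝓡 m) : M → Type) x₀
  exact ⟨Function.LeftInverse.injective (g := e.continuousLinearMapAt ℝ x)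
    fun v ↦ e.continuousLinearMapAt_symmL hx v, Function.RightInverse.surjective
    (g := e.continuousLinearMapAt ℝ x) fun v ↦ e.symmL_continuousLinearMapAt hx v⟩

theorem chartFrame_eq_coordVector {x₀ : M} {u : EuclideanSpace ℝ (Fin m)}
    (hu : u ∈ (extChartAt (𝓡 m) x₀).target) (i : Fin m) :
    chartFrame x₀ ((extChartAt (𝓡 m) x₀).symm u) (EuclideanSpace.single i 1) =
      coordVector x₀ u i := by
  rw [chartFrame, PartialEquiv.right_inv _ hu, coordVector]
  rfl

theorem continuousOn_chartFrame [IsManifold (𝓡 m) ∞ M] (x₀ : M) (v : EuclideanSpace ℝ (Fin m)) :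
    ContinuousOn (fun x : M ↦ (⟨x, chartFrame x₀ x v⟩ : TotalSpace (EuclideanSpace ℝ (Fin m))
      (TangentSpace (𝓡 m) : M → Type))) (extChartAt (𝓡 m) x₀).source := by
  have : IsManifold (𝓡 m) 1 M := .of_le (n := ∞) (by simp)
  set e := trivializationAt (EuclideanSpace ℝ (Fin m)) (TangentSpace (𝓡 m) : M → Type) x₀
  have h1 := e.continuousOn_symm.comp (f := fun x : M ↦ (x, v))
    (s := (extChartAt (𝓡 m) x₀).source) (Continuous.continuousOn (by fun_prop)) (by
      intro x hx
      rw [extChartAt_source] at hx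
      exact ⟨hx, trivial⟩)
  refine h1.congr fun x hx ↦ ?_
  rw [extChartAt_source] at hx
  rw [chartFrame_eq_symmL (by rwa [extChartAt_source]), e.symmL_apply hx]
  rfl

variable [RiemannianBundle (fun x : M ↦ TangentSpace (𝓡 m) x)]

/-- The Gram matrix of the coordinate frame of the chart around `x₀`. -/
def chartGram (x₀ x : M) : Matrix (Fin m) (Fin m) ℝ :=
  .of fun i j ↦ inner ℝ (chartFrame x₀ x (EuclideanSpace.single i 1))
    (chartFrame x₀ x (EuclideanSpace.single j 1))

theorem continuousOn_chartGram [IsManifold (𝓡 m) ∞ M]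
    [IsContMDiffRiemannianBundle (𝓡 m) ∞ (EuclideanSpace ℝ (Fin m))
      (fun x : M ↦ TangentSpace (𝓡 m) x)] (x₀ : M) :
    ContinuousOn (chartGram (m := m) x₀) (extChartAt (𝓡 m) x₀).source := by
  refine continuousOn_pi.2 fun i ↦ continuousOn_pi.2 fun j ↦ ?_
  have : IsManifold (𝓡 m) 1 M := .of_le (n := ∞) (by simp)
  have : IsContinuousRiemannianBundle (EuclideanSpace ℝ (Fin m))
      (fun x : M ↦ TangentSpace (𝓡 m) x) := by
    obtain ⟨g, hg, hg'⟩ := IsContMDiffRiemannianBundle.exists_contMDiff (IB := 𝓡 m) (n := ∞)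
      (F := EuclideanSpace ℝ (Fin m)) (E := fun x : M ↦ TangentSpace (𝓡 m) x)
    exact ⟨g, hg.continuous, hg'⟩
  exact (continuousOn_chartFrame x₀ (EuclideanSpace.single i 1)).inner_bundle
    (continuousOn_chartFrame x₀ (EuclideanSpace.single j 1))

/-- The components of a `2`-form in the coordinate frame of the chart around `x₀`. -/
def formComponents (x₀ x : M) (η : TangentSpace (𝓡 m) x [⋀^Fin 2]→L[ℝ] ℝ) :
    Matrix (Fin m) (Fin m) ℝ :=
  .of fun i j ↦ η ![chartFrame x₀ x (EuclideanSpace.single i 1),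
    chartFrame x₀ x (EuclideanSpace.single j 1)]

/-- The inner product of two `2`-forms with components `A` and `B` in the coordinate frame of the
chart around `x₀`. -/
def chartPairing (x₀ x : M) (A B : Matrix (Fin m) (Fin m) ℝ) : ℝ :=
  (Aᵀ * (chartGram x₀ x)⁻¹ * B * (chartGram x₀ x)⁻¹).trace / 2

/-- The pointwise inner product of `2`-forms whose squared norm is `formNormSq`. -/
def formInner (x : M) (η ξ : TangentSpace (𝓡 m) x [⋀^Fin 2]→L[ℝ] ℝ) : ℝ :=
  haveI : FiniteDimensional ℝ (TangentSpace (𝓡 m) x) :=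
    inferInstanceAs (FiniteDimensional ℝ (EuclideanSpace ℝ (Fin m)))
  let e := stdOrthonormalBasis ℝ (TangentSpace (𝓡 m) x)
  ∑ i, ∑ j ∈ Finset.Ioi i, η ![e i, e j] * ξ ![e i, e j]

theorem formInner_self (x : M) (η : TangentSpace (𝓡 m) x [⋀^Fin 2]→L[ℝ] ℝ) :
    formInner x η η = formNormSq x η := by
  simp [formInner, formNormSq, sq]

/-- This pointwise inequality is the only place where positivity of the norm enters; it turns
invariance of the pairing into minimality. -/
theorem two_mul_formInner_le (x : M) (η ξ : TangentSpace (𝓡 m) x [⋀^Fin 2]→L[ℝ] ℝ) :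
    2 * formInner x η ξ ≤ formNormSq x η + formNormSq x ξ := by
  simp only [formInner, formNormSq, Finset.mul_sum, ← Finset.sum_add_distrib]
  refine Finset.sum_le_sum fun i _ ↦ Finset.sum_le_sum fun j _ ↦ ?_
  rw [← mul_assoc]
  exact two_mul_le_add_sq _ _

/-- Replaces the sum over `i < j` by half of a full double sum, which can be read as a trace and so
is easy to transform under a change of frame. -/
theorem sum_sum_Ioi_of_symm {k : ℕ} (a : Fin k → Fin k → ℝ) (hs : ∀ i j, a i j = a j i)
    (h0 : ∀ i, a i i = 0) : ∑ i, ∑ j ∈ Finset.Ioi i, a i j = (∑ i, ∑ j, a i j) / 2 := by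
  have h1 : ∑ i, ∑ j, a i j = ∑ i, ∑ j ∈ Finset.Ioi i, a i j + ∑ i, ∑ j ∈ Finset.Iio i, a i j := by
    rw [← Finset.sum_add_distrib]
    refine Finset.sum_congr rfl fun i _ ↦ ?_
    have : (Finset.univ : Finset (Fin k)) =
        (Finset.Ioi i ∪ Finset.Iio i) ∪ {i} := by
      ext j; simp; grind
    rw [this, Finset.sum_union, Finset.sum_union]
    · simp [h0]
    · exact Finset.disjoint_left.2 fun j hj hj' ↦ by simp at hj hj'; grind
    · simp
  have h2 : ∑ i, ∑ j ∈ Finset.Iio i, a i j = ∑ i, ∑ j ∈ Finset.Ioi i, a i j := by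
    rw [Finset.sum_comm' (t' := Finset.univ) (s' := fun j ↦ Finset.Ioi j) (by simp)]
    exact Finset.sum_congr rfl fun i _ ↦ Finset.sum_congr rfl fun j _ ↦ hs _ _
  rw [h1, h2]; ring

/-- A `2`-form as a bilinear form. -/
def formBilin {V : Type*} [AddCommGroup V] [Module ℝ V] [TopologicalSpace V]
    (η : V [⋀^Fin 2]→L[ℝ] ℝ) : LinearMap.BilinForm ℝ V :=
  LinearMap.mk₂ ℝ (fun v w ↦ η ![v, w]) (fun v v' w ↦ η.vecCons_add _ v v')
    (fun c v w ↦ η.vecCons_smul _ c v)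
    (fun v w w' ↦ by
      have hu (x : V) : Function.update ![v, w] 1 x = ![v, x] := by
        funext i; fin_cases i <;> rfl
      simpa only [hu] using η.map_update_add ![v, w] 1 w w')
    (fun c v w ↦ by
      have hu (x : V) : Function.update ![v, w] 1 x = ![v, x] := by
        funext i; fin_cases i <;> rfl
      simpa only [hu] using η.map_update_smul ![v, w] 1 c w)

theorem twoForm_apply_self {V : Type*} [AddCommGroup V] [Module ℝ V] [TopologicalSpace V]
    (η : V [⋀^Fin 2]→L[ℝ] ℝ) (v : V) : η ![v, v] = 0 :=
  η.map_eq_zero_of_eq ![v, v] (i := 0) (j := 1) rfl (by simp)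

theorem twoForm_apply_swap {V : Type*} [AddCommGroup V] [Module ℝ V] [TopologicalSpace V]
    (η : V [⋀^Fin 2]→L[ℝ] ℝ) (v w : V) : η ![v, w] = -η ![w, v] := by
  have h := twoForm_apply_self η (v + w)
  have h' : formBilin η (v + w) (v + w) = 0 := h
  have h1 : formBilin η v v = 0 := twoForm_apply_self η v
  have h2 : formBilin η w w = 0 := twoForm_apply_self η w
  simp only [map_add, LinearMap.add_apply, h1, h2] at h'
  have : formBilin η v w = -formBilin η w v := by linarith
  exact this

/-- Frame independence of the pairing: if `P` expresses a frame in an orthonormal basis, forms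
transform by `A ↦ Pᵀ A P`, the Gram matrix of the frame is `Pᵀ P`, and all factors of `P` cancel
under the trace. -/
theorem trace_congruence_pairing {ι : Type*} [Fintype ι] [DecidableEq ι]
    (P A B : Matrix ι ι ℝ) (hP : IsUnit P.det) :
    ((Pᵀ * A * P)ᵀ * (Pᵀ * P)⁻¹ * (Pᵀ * B * P) * (Pᵀ * P)⁻¹).trace = (Aᵀ * B).trace := by
  have hPt : IsUnit (Pᵀ).det := by rwa [Matrix.det_transpose]
  have h1 : (Pᵀ * P)⁻¹ = P⁻¹ * (Pᵀ)⁻¹ := Matrix.mul_inv_rev _ _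
  have h2 : (Pᵀ * A * P)ᵀ = Pᵀ * Aᵀ * P := by simp [Matrix.mul_assoc]
  have e : (Pᵀ * A * P)ᵀ * (Pᵀ * P)⁻¹ * (Pᵀ * B * P) * (Pᵀ * P)⁻¹ =
      Pᵀ * (Aᵀ * ((P * P⁻¹) * (((Pᵀ)⁻¹ * Pᵀ) * (B * ((P * P⁻¹) * (Pᵀ)⁻¹))))) := by
    rw [h1, h2]; simp only [Matrix.mul_assoc]
  rw [e, Matrix.mul_nonsing_inv _ hP, Matrix.nonsing_inv_mul _ hPt, Matrix.one_mul, Matrix.one_mul,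
    Matrix.one_mul, Matrix.trace_mul_comm, Matrix.mul_assoc, Matrix.mul_assoc,
    Matrix.nonsing_inv_mul _ hPt, Matrix.mul_one]

/-- The orthonormal basis defining `formInner` is chosen separately at each point, with no
continuity. The expression in the coordinate frame is what makes regularity in `x` accessible. -/
theorem formInner_eq_chartPairing [IsManifold (𝓡 m) ∞ M] {x₀ x : M}
    (hx : x ∈ (extChartAt (𝓡 m) x₀).source) (η ξ : TangentSpace (𝓡 m) x [⋀^Fin 2]→L[ℝ] ℝ) :
    formInner x η ξ = chartPairing x₀ x (formComponents x₀ x η) (formComponents x₀ x ξ) := by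
  have : FiniteDimensional ℝ (TangentSpace (𝓡 m) x) :=
    inferInstanceAs (FiniteDimensional ℝ (EuclideanSpace ℝ (Fin m)))
  have hr : Module.finrank ℝ (TangentSpace (𝓡 m) x) = m :=
    (finrank_euclideanSpace_fin (𝕜 := ℝ) (n := m) :)
  let e := (stdOrthonormalBasis ℝ (TangentSpace (𝓡 m) x)).reindex (finCongr hr)
  have h1 : formInner x η ξ = (∑ i, ∑ j, η ![e i, e j] * ξ ![e i, e j]) / 2 := by
    simp only [formInner]
    rw [sum_sum_Ioi_of_symm _ (fun i j ↦ by
      rw [twoForm_apply_swap η, twoForm_apply_swap ξ, neg_mul_neg]) (fun i ↦ by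
      rw [twoForm_apply_self, zero_mul])]
    congr 1
    refine Fintype.sum_equiv (finCongr hr) _ _ fun i ↦ Fintype.sum_equiv (finCongr hr) _ _ fun j ↦ ?_
    simp [e]
  let b : Module.Basis (Fin m) ℝ (TangentSpace (𝓡 m) x) :=
    (EuclideanSpace.basisFun (Fin m) ℝ).toBasis.map
      (LinearEquiv.ofBijective (chartFrame x₀ x).toLinearMap (chartFrame_bijective hx))
  have hb (i : Fin m) : b i = chartFrame x₀ x (EuclideanSpace.single i 1) := by
    simp [b]
  let P := e.toBasis.toMatrix b
  have hP : IsUnit P.det := by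
    rw [← Matrix.isUnit_iff_isUnit_det]
    exact IsUnit.of_mul_eq_one _ (e.toBasis.toMatrix_mul_toMatrix_flip b)
  have hform (ζ : TangentSpace (𝓡 m) x [⋀^Fin 2]→L[ℝ] ℝ) : formComponents x₀ x ζ =
      Pᵀ * LinearMap.BilinForm.toMatrix e.toBasis (formBilin ζ) * P := by
    rw [LinearMap.BilinForm.toMatrix_mul_basis_toMatrix]
    ext i j
    simp [formComponents, hb, formBilin]
  have hgram : chartGram x₀ x = Pᵀ * P := by
    have h := LinearMap.BilinForm.toMatrix_mul_basis_toMatrix (b := e.toBasis) b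
      (innerₗ (TangentSpace (𝓡 m) x))
    have h' : LinearMap.BilinForm.toMatrix e.toBasis (innerₗ (TangentSpace (𝓡 m) x)) = 1 := by
      ext i j
      simp [LinearMap.BilinForm.toMatrix_apply, Matrix.one_apply,
        orthonormal_iff_ite.1 e.orthonormal]
    rw [h', Matrix.mul_one] at h
    rw [h]
    ext i j
    simp [chartGram, hb]
  rw [h1, chartPairing, hform, hform, hgram, trace_congruence_pairing _ _ _ hP, Matrix.trace]
  congr 1
  rw [Finset.sum_comm]
  simp [Matrix.mul_apply, formBilin]

theorem isUnit_det_chartGram [IsManifold (𝓡 m) ∞ M] {x₀ x : M}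
    (hx : x ∈ (extChartAt (𝓡 m) x₀).source) : IsUnit (chartGram (m := m) x₀ x).det := by
  have hli : LinearIndependent ℝ fun i : Fin m ↦
      chartFrame x₀ x (EuclideanSpace.single i (1 : ℝ)) := by
    have := (EuclideanSpace.basisFun (Fin m) ℝ).toBasis.linearIndependent.map'
      (chartFrame x₀ x).toLinearMap (LinearMap.ker_eq_bot.2 (chartFrame_bijective hx).1)
    have h (i : Fin m) : (⇑(chartFrame x₀ x).toLinearMap ∘
        ⇑(EuclideanSpace.basisFun (Fin m) ℝ).toBasis) i =
        chartFrame x₀ x (EuclideanSpace.single i (1 : ℝ)) := by simp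
    exact (funext h) ▸ this
  have h : (chartGram x₀ x) = Matrix.gram ℝ fun i : Fin m ↦
      chartFrame x₀ x (EuclideanSpace.single i (1 : ℝ)) := rfl
  rw [h]
  exact (Matrix.posDef_gram_of_linearIndependent hli).det_pos.ne'.isUnit

theorem continuousOn_chartGram_inv [IsManifold (𝓡 m) ∞ M]
    [IsContMDiffRiemannianBundle (𝓡 m) ∞ (EuclideanSpace ℝ (Fin m))
      (fun x : M ↦ TangentSpace (𝓡 m) x)] (x₀ : M) :
    ContinuousOn (fun x ↦ (chartGram (m := m) x₀ x)⁻¹) (extChartAt (𝓡 m) x₀).source := by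
  simp only [Matrix.inv_def, Ring.inverse_eq_inv']
  have h := continuousOn_chartGram (m := m) x₀
  refine ContinuousOn.smul (ContinuousOn.inv₀ ?_ fun x hx ↦ (isUnit_det_chartGram hx).ne_zero) ?_
  · exact Continuous.comp_continuousOn (g := Matrix.det) (by fun_prop) h
  · exact Continuous.comp_continuousOn (g := Matrix.adjugate) (by fun_prop) h

theorem continuousOn_chartPairing [IsManifold (𝓡 m) ∞ M]
    [IsContMDiffRiemannianBundle (𝓡 m) ∞ (EuclideanSpace ℝ (Fin m))
      (fun x : M ↦ TangentSpace (𝓡 m) x)] (x₀ : M) {X : Type*} [TopologicalSpace X] {p : X → M}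
    {A B : X → Matrix (Fin m) (Fin m) ℝ} {s : Set X} (hp : ContinuousOn p s)
    (hps : MapsTo p s (extChartAt (𝓡 m) x₀).source) (hA : ContinuousOn A s)
    (hB : ContinuousOn B s) : ContinuousOn (fun q ↦ chartPairing x₀ (p q) (A q) (B q)) s := by
  have h := (continuousOn_chartGram_inv (m := m) x₀).comp hp hps
  simp only [Function.comp_def] at h
  unfold chartPairing
  refine ContinuousOn.div_const ?_ _
  refine Continuous.comp_continuousOn (g := Matrix.trace) (by fun_prop) ?_
  exact ((ContinuousOn.mul (Continuous.comp_continuousOn (g := Matrix.transpose) (by fun_prop) hA)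
    h).mul hB).mul h

theorem volumeDensity_eq {x₀ : M} {u : EuclideanSpace ℝ (Fin m)}
    (hu : u ∈ (extChartAt (𝓡 m) x₀).target) :
    volumeDensity x₀ u = √(chartGram (m := m) x₀ ((extChartAt (𝓡 m) x₀).symm u)).det := by
  simp only [volumeDensity, chartGram, chartFrame_eq_coordVector hu]

theorem continuousOn_volumeDensity [IsManifold (𝓡 m) ∞ M]
    [IsContMDiffRiemannianBundle (𝓡 m) ∞ (EuclideanSpace ℝ (Fin m))
      (fun x : M ↦ TangentSpace (𝓡 m) x)] (x₀ : M) :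
    ContinuousOn (volumeDensity (m := m) x₀) (extChartAt (𝓡 m) x₀).target := by
  have h := (continuousOn_chartGram (m := m) x₀).comp (continuousOn_extChartAt_symm x₀)
    (extChartAt (𝓡 m) x₀).mapsTo_symm
  refine ContinuousOn.congr (ContinuousOn.sqrt (Continuous.comp_continuousOn (g := Matrix.det)
    (by fun_prop) h)) fun u hu ↦ volumeDensity_eq hu

/-- The support of `ρ` is compact inside the chart domain, so the continuous volume density is
bounded on its image, which has finite Lebesgue measure. -/
theorem lintegral_chartVolume_lt_top [IsManifold (𝓡 m) ∞ M]
    [IsContMDiffRiemannianBundle (𝓡 m) ∞ (EuclideanSpace ℝ (Fin m))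
      (fun x : M ↦ TangentSpace (𝓡 m) x)] [CompactSpace M] [MeasurableSpace M] (x₀ : M)
    {ρ : M → ℝ} (hρ : ∀ x, ρ x ≤ 1) (hs : tsupport ρ ⊆ (extChartAt (𝓡 m) x₀).source) :
    ∫⁻ p, ENNReal.ofReal (ρ p) ∂(chartVolume m x₀) < ⊤ := by
  set K := extChartAt (𝓡 m) x₀ '' tsupport ρ
  have hK : IsCompact K := (isClosed_tsupport ρ).isCompact.image_of_continuousOn
    ((continuousOn_extChartAt x₀).mono hs)
  have hKt : K ⊆ (extChartAt (𝓡 m) x₀).target := by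
    rintro _ ⟨x, hx, rfl⟩
    exact (extChartAt (𝓡 m) x₀).map_source (hs hx)
  have hvd : ContinuousOn (volumeDensity (m := m) x₀) K :=
    (continuousOn_volumeDensity x₀).mono hKt
  obtain ⟨C, hC⟩ := hK.exists_bound_of_continuousOn hvd
  have ht : MeasurableSet (extChartAt (𝓡 m) x₀).target :=
    (isOpen_extChartAt_target x₀).measurableSet
  have hρ0 {u : EuclideanSpace ℝ (Fin m)} (hu : u ∈ (extChartAt (𝓡 m) x₀).target) (huK : u ∉ K) :
      ρ ((extChartAt (𝓡 m) x₀).symm u) = 0 := by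
    refine image_eq_zero_of_notMem_tsupport fun h ↦ huK ⟨_, h, ?_⟩
    exact (extChartAt (𝓡 m) x₀).right_inv hu
  -- Only an upper bound is needed, so the inequality for integrals against a push-forward suffices
  -- and no measurability of the inverse chart has to be checked.
  calc ∫⁻ p, ENNReal.ofReal (ρ p) ∂(chartVolume m x₀)
      ≤ ∫⁻ u, ENNReal.ofReal (ρ ((extChartAt (𝓡 m) x₀).symm u))
          ∂((volume.restrict (extChartAt (𝓡 m) x₀).target).withDensity
            fun u ↦ ENNReal.ofReal (volumeDensity x₀ u)) := lintegral_map_le _ _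
    _ ≤ ∫⁻ u, K.indicator 1 u ∂((volume.restrict (extChartAt (𝓡 m) x₀).target).withDensity
            fun u ↦ ENNReal.ofReal (volumeDensity x₀ u)) := by
        refine lintegral_mono_ae ?_
        have := (withDensity_absolutelyContinuous (volume.restrict (extChartAt (𝓡 m) x₀).target)
          fun u ↦ ENNReal.ofReal (volumeDensity x₀ u)).ae_le (ae_restrict_mem ht)
        filter_upwards [this] with u hu
        by_cases huK : u ∈ K
        · simpa [huK] using hρ _
        · rw [hρ0 hu huK]; simp
    _ = ∫⁻ u in K, ENNReal.ofReal (volumeDensity x₀ u) := by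
        rw [lintegral_indicator_one hK.measurableSet, withDensity_apply _ hK.measurableSet,
          Measure.restrict_restrict hK.measurableSet, inter_eq_left.2 hKt]
    _ ≤ ∫⁻ _ in K, ENNReal.ofReal C := by
        refine setLIntegral_mono' hK.measurableSet fun u hu ↦ ENNReal.ofReal_le_ofReal ?_
        exact (le_abs_self _).trans (hC u hu)
    _ < ⊤ := by
        rw [setLIntegral_const]
        exact ENNReal.mul_lt_top ENNReal.ofReal_lt_top hK.measure_lt_top

/-- By compactness only finitely many functions of the locally finite partition of unity are
nonzero, so the sum of measures is effectively finite. -/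
theorem isFiniteMeasure_riemannianVolume [IsManifold (𝓡 m) ∞ M]
    [IsContMDiffRiemannianBundle (𝓡 m) ∞ (EuclideanSpace ℝ (Fin m))
      (fun x : M ↦ TangentSpace (𝓡 m) x)] [T2Space M] [CompactSpace M] [MeasurableSpace M] :
    IsFiniteMeasure (riemannianVolume m M) := by
  set ρ := (SmoothPartitionOfUnity.exists_isSubordinate_chartAt_source (𝓡 m) M).choose with hρ
  have hsub := (SmoothPartitionOfUnity.exists_isSubordinate_chartAt_source (𝓡 m) M).choose_spec
  have hfin : {x : M | (Function.support (ρ x)).Nonempty}.Finite :=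
    ρ.locallyFinite.finite_nonempty_of_compact
  refine ⟨?_⟩
  rw [riemannianVolume, Measure.sum_apply _ MeasurableSet.univ]
  simp only [withDensity_apply _ MeasurableSet.univ, Measure.restrict_univ]
  rw [tsum_eq_sum (s := hfin.toFinset)]
  · refine ENNReal.sum_lt_top.2 fun x _ ↦ lintegral_chartVolume_lt_top x
      (fun p ↦ ρ.le_one x p) ?_
    rw [extChartAt_source]
    exact hsub x
  · intro x hx
    have : ∀ p, ρ x p = 0 := by
      by_contra! h
      exact hx (hfin.mem_toFinset.2 h)
    simp [← hρ, this]

end Metric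

/-! ### Variation of a pulled-back 2-form in vector spaces -/

section FlatCalculus

set_option maxSynthPendingDepth 3

variable {E F : Type*} [NormedAddCommGroup E] [NormedSpace ℝ E] [NormedAddCommGroup F]
  [NormedSpace ℝ F]

/-- The pull-back `(g^*B)_u (a, b)` of a field `B` of bilinear forms under a map `g`. -/
def pullForm (B : F → F →L[ℝ] F →L[ℝ] ℝ) (g : E → F) (u a b : E) : ℝ :=
  B (g u) (fderiv ℝ g u a) (fderiv ℝ g u b)

/-- The derivative of `pullForm B g` when `g` varies in the direction `V`. -/
def pullFormVar (B : F → F →L[ℝ] F →L[ℝ] ℝ) (g V : E → F) (u a b : E) : ℝ :=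
  fderiv ℝ B (g u) (V u) (fderiv ℝ g u a) (fderiv ℝ g u b) +
    B (g u) (fderiv ℝ V u a) (fderiv ℝ g u b) + B (g u) (fderiv ℝ g u a) (fderiv ℝ V u b)

/-- The `1`-form `B (V, dg ·)` along `g`. -/
def contractForm (B : F → F →L[ℝ] F →L[ℝ] ℝ) (g V : E → F) (b u : E) : ℝ :=
  B (g u) (V u) (fderiv ℝ g u b)

theorem fderiv_add_smul {g V : E → F} {u : E} (hg : DifferentiableAt ℝ g u)
    (hV : DifferentiableAt ℝ V u) (t : ℝ) :
    fderiv ℝ (fun u ↦ g u + t • V u) u = fderiv ℝ g u + t • fderiv ℝ V u :=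
  (hg.hasFDerivAt.add (hV.hasFDerivAt.const_smul t)).fderiv

theorem hasDerivAt_pullForm {B : F → F →L[ℝ] F →L[ℝ] ℝ} {g V : E → F} {u : E} {t : ℝ}
    (hB : DifferentiableAt ℝ B (g u + t • V u)) (hg : DifferentiableAt ℝ g u)
    (hV : DifferentiableAt ℝ V u) (a b : E) :
    HasDerivAt (fun t ↦ pullForm B (fun u ↦ g u + t • V u) u a b)
      (pullFormVar B (fun u ↦ g u + t • V u) V u a b) t := by
  have hl {G : Type _} [NormedAddCommGroup G] [NormedSpace ℝ G] (p q : G) :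
      HasDerivAt (fun s : ℝ ↦ p + s • q) q t := by
    simpa using ((hasDerivAt_id t).smul_const q).const_add p
  have h1 : HasDerivAt (fun s : ℝ ↦ B (g u + s • V u)) (fderiv ℝ B (g u + t • V u) (V u)) t :=
    hB.hasFDerivAt.comp_hasDerivAt t (hl (g u) (V u))
  have h2 := (h1.clm_apply (hl (fderiv ℝ g u a) (fderiv ℝ V u a))).clm_apply
    (hl (fderiv ℝ g u b) (fderiv ℝ V u b))
  simp only [pullForm, pullFormVar, fderiv_add_smul hg hV]
  refine h2.congr_deriv ?_
  simp only [add_apply, smul_apply]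

/-- Cartan's formula along a map: the derivative of the pull-back is `d` of the contraction plus the
contraction of `dB`, and the latter vanishes. Differentiating the contraction also produces second
derivatives of `g`, which cancel by symmetry. -/
theorem pullFormVar_eq {B : F → F →L[ℝ] F →L[ℝ] ℝ} {g V : E → F} {u : E}
    (hB : DifferentiableAt ℝ B (g u)) (hg : ContDiffAt ℝ 2 g u) (hV : DifferentiableAt ℝ V u)
    (hanti : ∀ x v w, B x v w = -B x w v)
    (hclosed : ∀ x y z, fderiv ℝ B (g u) x y z - fderiv ℝ B (g u) y x z +
      fderiv ℝ B (g u) z x y = 0) (a b : E) :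
    pullFormVar B g V u a b =
      fderiv ℝ (contractForm B g V b) u a - fderiv ℝ (contractForm B g V a) u b := by
  have hg1 : DifferentiableAt ℝ g u := hg.differentiableAt (by norm_num)
  have hg2 : DifferentiableAt ℝ (fderiv ℝ g) u :=
    (hg.fderiv_right (m := 1) (by norm_num)).differentiableAt (by norm_num)
  have hsymm : IsSymmSndFDerivAt ℝ g u := hg.isSymmSndFDerivAt (by simp)
  have key (c d : E) : fderiv ℝ (contractForm B g V c) u d =
      fderiv ℝ B (g u) (fderiv ℝ g u d) (V u) (fderiv ℝ g u c) +
        B (g u) (fderiv ℝ V u d) (fderiv ℝ g u c) +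
        B (g u) (V u) (fderiv ℝ (fderiv ℝ g) u d c) := by
    have h1 : HasFDerivAt (fun u ↦ B (g u)) ((fderiv ℝ B (g u)).comp (fderiv ℝ g u)) u :=
      hB.hasFDerivAt.comp u hg1.hasFDerivAt
    have h2 : HasFDerivAt (fun u ↦ fderiv ℝ g u c) ((fderiv ℝ (fderiv ℝ g) u).flip c) u := by
      simpa using hg2.hasFDerivAt.clm_apply (hasFDerivAt_const c u)
    have h3 := (h1.clm_apply hV.hasFDerivAt).clm_apply h2
    have h4 := h3.fderiv
    unfold contractForm
    rw [h4]
    simp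
    ring
  have hanti' : ∀ x y z, fderiv ℝ B (g u) x y z = -fderiv ℝ B (g u) x z y := by
    intro x y z
    have h1 : HasFDerivAt (fun p ↦ B p y z) (((fderiv ℝ B (g u)).flip y).flip z) (g u) := by
      simpa using (hB.hasFDerivAt.clm_apply (hasFDerivAt_const y _)).clm_apply (hasFDerivAt_const z _)
    have h2 : HasFDerivAt (fun p ↦ -B p z y) (-((fderiv ℝ B (g u)).flip z).flip y) (g u) := by
      have h : HasFDerivAt (fun p ↦ B p z y) (((fderiv ℝ B (g u)).flip z).flip y) (g u) := by
        simpa using (hB.hasFDerivAt.clm_apply (hasFDerivAt_const z _)).clm_apply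
          (hasFDerivAt_const y _)
      exact h.fun_neg
    have h3 : (fun p ↦ B p y z) = fun p ↦ -B p z y := funext fun p ↦ hanti p y z
    rw [h3] at h1
    simpa using congrArg (fun L ↦ L x) (h1.unique h2)
  -- With the second derivatives of `g` identified, closedness on `(V, dg a, dg b)` matches the
  -- terms in the derivative of `B`, and antisymmetry of `B` matches the remaining one.
  rw [key, key, pullFormVar, hsymm.eq b a]
  have h1 := hclosed (V u) (fderiv ℝ g u a) (fderiv ℝ g u b)
  have h2 := hanti (g u) (fderiv ℝ g u a) (fderiv ℝ V u b)
  linarith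

/-- Continuity is joint in time and space because it later provides a uniform bound for
differentiation under the integral. -/
theorem continuousOn_pullFormVar {B : F → F →L[ℝ] F →L[ℝ] ℝ} {g V : E → F} {O : Set E} {T : Set F}
    (hO : IsOpen O) (hT : IsOpen T) (hB : ContDiffOn ℝ 1 B T) (hg : ContDiffOn ℝ 1 g O)
    (hV : ContDiffOn ℝ 1 V O) (a b : E) :
    ContinuousOn (fun p : ℝ × E ↦ pullFormVar B (fun u ↦ g u + p.1 • V u) V p.2 a b)
      {p | p.2 ∈ O ∧ g p.2 + p.1 • V p.2 ∈ T} := by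
  set S := {p : ℝ × E | p.2 ∈ O ∧ g p.2 + p.1 • V p.2 ∈ T}
  have hsnd : MapsTo (Prod.snd : ℝ × E → E) S O := fun p hp ↦ hp.1
  have cg : ContinuousOn (fun p : ℝ × E ↦ g p.2) S := hg.continuousOn.comp continuousOn_snd hsnd
  have cV : ContinuousOn (fun p : ℝ × E ↦ V p.2) S := hV.continuousOn.comp continuousOn_snd hsnd
  have cdg : ContinuousOn (fun p : ℝ × E ↦ fderiv ℝ g p.2) S :=
    (hg.continuousOn_fderiv_of_isOpen hO le_rfl).comp continuousOn_snd hsnd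
  have cdV : ContinuousOn (fun p : ℝ × E ↦ fderiv ℝ V p.2) S :=
    (hV.continuousOn_fderiv_of_isOpen hO le_rfl).comp continuousOn_snd hsnd
  have cgt : ContinuousOn (fun p : ℝ × E ↦ g p.2 + p.1 • V p.2) S :=
    cg.add (continuousOn_fst.smul cV)
  have cB : ContinuousOn (fun p : ℝ × E ↦ B (g p.2 + p.1 • V p.2)) S :=
    hB.continuousOn.comp cgt fun p hp ↦ hp.2
  have cdB : ContinuousOn (fun p : ℝ × E ↦ fderiv ℝ B (g p.2 + p.1 • V p.2)) S :=
    (hB.continuousOn_fderiv_of_isOpen hT le_rfl).comp cgt fun p hp ↦ hp.2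
  have cdgt : ContinuousOn (fun p : ℝ × E ↦ fderiv ℝ g p.2 + p.1 • fderiv ℝ V p.2) S :=
    cdg.add (continuousOn_fst.smul cdV)
  have h (c : E) := cdgt.clm_apply (continuousOn_const (c := c))
  have h' (c : E) := cdV.clm_apply (continuousOn_const (c := c))
  refine ContinuousOn.congr (f := fun p : ℝ × E ↦
    fderiv ℝ B (g p.2 + p.1 • V p.2) (V p.2) ((fderiv ℝ g p.2 + p.1 • fderiv ℝ V p.2) a)
      ((fderiv ℝ g p.2 + p.1 • fderiv ℝ V p.2) b) +
    B (g p.2 + p.1 • V p.2) (fderiv ℝ V p.2 a) ((fderiv ℝ g p.2 + p.1 • fderiv ℝ V p.2) b) +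
    B (g p.2 + p.1 • V p.2) ((fderiv ℝ g p.2 + p.1 • fderiv ℝ V p.2) a) (fderiv ℝ V p.2 b)) ?_ ?_
  · exact ((((cdB.clm_apply cV).clm_apply (h a)).clm_apply (h b)).add
      ((cB.clm_apply (h' a)).clm_apply (h b))).add ((cB.clm_apply (h a)).clm_apply (h' b))
  · intro p hp
    have hgd : DifferentiableAt ℝ g p.2 :=
      (hg.contDiffAt (hO.mem_nhds hp.1)).differentiableAt (by norm_num)
    have hVd : DifferentiableAt ℝ V p.2 :=
      (hV.contDiffAt (hO.mem_nhds hp.1)).differentiableAt (by norm_num)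
    simp only [pullFormVar, fderiv_add_smul hgd hVd]

theorem continuousOn_pullForm {B : F → F →L[ℝ] F →L[ℝ] ℝ} {g : E → F} {O : Set E} {T : Set F}
    (hO : IsOpen O) (hB : ContinuousOn B T) (hg : ContDiffOn ℝ 1 g O) (hgT : MapsTo g O T)
    (a b : E) : ContinuousOn (fun u ↦ pullForm B g u a b) O := by
  have cdg := hg.continuousOn_fderiv_of_isOpen hO le_rfl
  exact ((hB.comp hg.continuousOn hgT).clm_apply (cdg.clm_apply continuousOn_const)).clm_apply
    (cdg.clm_apply continuousOn_const)

variable (E) in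
/-- Currying of alternating `2`-forms, as a continuous linear map. -/
def curryTwoForm : (E [⋀^Fin 2]→L[ℝ] ℝ) →L[ℝ] E →L[ℝ] E →L[ℝ] ℝ :=
  (ContinuousLinearMap.compL ℝ E (E [×1]→L[ℝ] ℝ) (E →L[ℝ] ℝ)
      (continuousMultilinearCurryFin1 ℝ E ℝ).toContinuousLinearEquiv.toContinuousLinearMap) ∘L
    (continuousMultilinearCurryLeftEquiv ℝ (fun _ : Fin 2 ↦ E)
      ℝ).toContinuousLinearEquiv.toContinuousLinearMap ∘L
    ContinuousAlternatingMap.toContinuousMultilinearMapCLM ℝ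

theorem curryTwoForm_apply (η : E [⋀^Fin 2]→L[ℝ] ℝ) (v w : E) :
    curryTwoForm E η v w = η ![v, w] := by
  simp only [curryTwoForm, ContinuousLinearMap.comp_apply]
  change η (Fin.cons v (Fin.snoc 0 w)) = _
  congr 1
  funext i
  fin_cases i <;> rfl

/-- The alternating sum defining `extDeriv`, evaluated on three vectors, in the form that
`pullFormVar_eq` consumes. -/
theorem curryTwoForm_closed {β : E → E [⋀^Fin 2]→L[ℝ] ℝ} {p : E} (hβ : DifferentiableAt ℝ β p)
    (h : extDeriv β p = 0) (x y z : E) :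
    fderiv ℝ (fun u ↦ curryTwoForm E (β u)) p x y z -
      fderiv ℝ (fun u ↦ curryTwoForm E (β u)) p y x z +
      fderiv ℝ (fun u ↦ curryTwoForm E (β u)) p z x y = 0 := by
  have h1 : fderiv ℝ (fun u ↦ curryTwoForm E (β u)) p = (curryTwoForm E).comp (fderiv ℝ β p) :=
    ((curryTwoForm E).hasFDerivAt.comp p hβ.hasFDerivAt).fderiv
  have h2 := congrArg (fun η ↦ η ![x, y, z]) h
  simp only [extDeriv, ContinuousAlternatingMap.alternatizeUncurryFin_apply] at h2
  have r0 : Fin.removeNth 0 ![x, y, z] = ![y, z] := by funext i; fin_cases i <;> rfl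
  have r1 : Fin.removeNth 1 ![x, y, z] = ![x, z] := by funext i; fin_cases i <;> rfl
  have r2 : Fin.removeNth 2 ![x, y, z] = ![x, y] := by funext i; fin_cases i <;> rfl
  have h3 : ∑ i : Fin 3, (-1 : ℤ) ^ (i : ℕ) •
      (fderiv ℝ β p (![x, y, z] i)) (i.removeNth ![x, y, z]) = 0 := h2
  rw [Fin.sum_univ_three, r0, r1, r2] at h3
  simp only [h1, ContinuousLinearMap.comp_apply, curryTwoForm_apply]
  simp at h3
  linarith

end FlatCalculus

/-! ### Maps and symplectic forms in charts -/

section Charts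

open Filter Topology

set_option maxSynthPendingDepth 3

variable {m n : ℕ}
  {M : Type*} [TopologicalSpace M] [ChartedSpace (EuclideanSpace ℝ (Fin m)) M]
  {N : Type*} [TopologicalSpace N] [ChartedSpace (EuclideanSpace ℝ (Fin n)) N]

/-- The expression of a symplectic form in a chart, as a field of bilinear forms. -/
def SymplecticForm.curried (Ω : SymplecticForm n N) (y₀ : N) (u : EuclideanSpace ℝ (Fin n)) :
    EuclideanSpace ℝ (Fin n) →L[ℝ] EuclideanSpace ℝ (Fin n) →L[ℝ] ℝ :=
  curryTwoForm (EuclideanSpace ℝ (Fin n)) (formInChart Ω.form y₀ u)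

theorem SymplecticForm.contDiffOn_curried (Ω : SymplecticForm n N) (y₀ : N) :
    ContDiffOn ℝ ∞ (Ω.curried y₀) (extChartAt (𝓡 n) y₀).target :=
  (curryTwoForm (EuclideanSpace ℝ (Fin n))).contDiff.comp_contDiffOn (Ω.smooth y₀)

theorem SymplecticForm.curried_swap (Ω : SymplecticForm n N) (y₀ : N)
    (u v w : EuclideanSpace ℝ (Fin n)) : Ω.curried y₀ u v w = -Ω.curried y₀ u w v := by
  simp only [curried, curryTwoForm_apply]
  exact twoForm_apply_swap _ _ _

theorem SymplecticForm.curried_closed (Ω : SymplecticForm n N) (y₀ : N)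
    {u : EuclideanSpace ℝ (Fin n)} (hu : u ∈ (extChartAt (𝓡 n) y₀).target)
    (x y z : EuclideanSpace ℝ (Fin n)) :
    fderiv ℝ (Ω.curried y₀) u x y z - fderiv ℝ (Ω.curried y₀) u y x z +
      fderiv ℝ (Ω.curried y₀) u z x y = 0 :=
  curryTwoForm_closed (((Ω.smooth y₀).contDiffAt
    ((isOpen_extChartAt_target y₀).mem_nhds hu)).differentiableAt (by simp)) (Ω.closed y₀ u hu) x y z

theorem chartFrame_mfderiv_extChartAt [IsManifold (𝓡 n) ∞ N] {y₀ y : N}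
    (hy : y ∈ (extChartAt (𝓡 n) y₀).source) (w : TangentSpace (𝓡 n) y) :
    chartFrame y₀ y (mfderiv (𝓡 n) 𝓘(ℝ, EuclideanSpace ℝ (Fin n)) (extChartAt (𝓡 n) y₀) y w) =
      w := by
  have : IsManifold (𝓡 n) 1 N := .of_le (n := ∞) (by simp)
  rw [chartFrame_eq_symmL hy]
  rw [extChartAt_source] at hy
  rw [← TangentBundle.continuousLinearMapAt_trivializationAt hy]
  exact Trivialization.symmL_continuousLinearMapAt _ hy w

theorem SymplecticForm.curried_apply_chart [IsManifold (𝓡 n) ∞ N] (Ω : SymplecticForm n N)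
    {y₀ y : N} (hy : y ∈ (extChartAt (𝓡 n) y₀).source) (v w : EuclideanSpace ℝ (Fin n)) :
    Ω.curried y₀ (extChartAt (𝓡 n) y₀ y) v w =
      Ω.form y ![chartFrame y₀ y v, chartFrame y₀ y w] := by
  -- The base points `z` and `y` are equal but not syntactically so, and the type of `Ω.form z`
  -- depends on `z`. Viewing both forms on the model space lets the equality be substituted.
  have key (z : N) (hz : z = y) (F : EuclideanSpace ℝ (Fin n) →L[ℝ] EuclideanSpace ℝ (Fin n)) :
      (show EuclideanSpace ℝ (Fin n) [⋀^Fin 2]→L[ℝ] ℝ from Ω.form z) ![F v, F w] =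
        (show EuclideanSpace ℝ (Fin n) [⋀^Fin 2]→L[ℝ] ℝ from Ω.form y) ![F v, F w] := by
    rw [hz]
  have h := key _ ((extChartAt (𝓡 n) y₀).left_inv hy) (chartFrame y₀ y)
  rw [curried, curryTwoForm_apply, formInChart]
  refine Eq.trans ?_ h
  refine congrArg (DFunLike.coe
    (Ω.form ((extChartAt (𝓡 n) y₀).symm (extChartAt (𝓡 n) y₀ y)))) ?_
  funext i
  fin_cases i <;> rfl

theorem SymplecticForm.curried_nondegenerate [IsManifold (𝓡 n) ∞ N] (Ω : SymplecticForm n N)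
    {y₀ y : N} (hy : y ∈ (extChartAt (𝓡 n) y₀).source) {v : EuclideanSpace ℝ (Fin n)}
    (h : ∀ w, Ω.curried y₀ (extChartAt (𝓡 n) y₀ y) w v = 0) : v = 0 := by
  have hb := chartFrame_bijective hy
  have : chartFrame y₀ y v = 0 := by
    refine Ω.nondegenerate y _ fun w ↦ ?_
    obtain ⟨w, rfl⟩ := hb.2 w
    rw [← Ω.curried_apply_chart hy, Ω.curried_swap, h, neg_zero]
  exact hb.1 (by rw [this, map_zero])

/-- The expression of a map `f : M → N` in the charts around `x₀` and `y₀`. -/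
def coordRep (x₀ : M) (y₀ : N) (f : M → N) (u : EuclideanSpace ℝ (Fin m)) :
    EuclideanSpace ℝ (Fin n) :=
  extChartAt (𝓡 n) y₀ (f ((extChartAt (𝓡 m) x₀).symm u))

variable (m) in
/-- The part of the target of the chart around `x₀` that corresponds to `U`. -/
def coordDomain (x₀ : M) (U : Set M) : Set (EuclideanSpace ℝ (Fin m)) :=
  (extChartAt (𝓡 m) x₀).target ∩ (extChartAt (𝓡 m) x₀).symm ⁻¹' U

theorem isOpen_coordDomain (x₀ : M) {U : Set M} (hU : IsOpen U) : IsOpen (coordDomain m x₀ U) :=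
  (continuousOn_extChartAt_symm x₀).isOpen_inter_preimage (isOpen_extChartAt_target x₀) hU

theorem mem_coordDomain {x₀ x : M} {U : Set M} (hx : x ∈ (extChartAt (𝓡 m) x₀).source)
    (hU : x ∈ U) : extChartAt (𝓡 m) x₀ x ∈ coordDomain m x₀ U :=
  ⟨(extChartAt (𝓡 m) x₀).map_source hx, by
    rw [mem_preimage, (extChartAt (𝓡 m) x₀).left_inv hx]; exact hU⟩

theorem contDiffOn_comp_extChartAt_symm [IsManifold (𝓡 m) ∞ M] {F : Type*} [NormedAddCommGroup F]
    [NormedSpace ℝ F] (x₀ : M) {V : M → F} {U : Set M} (hV : ContMDiffOn (𝓡 m) 𝓘(ℝ, F) ∞ V U) :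
    ContDiffOn ℝ ∞ (V ∘ (extChartAt (𝓡 m) x₀).symm) (coordDomain m x₀ U) := by
  rw [← contMDiffOn_iff_contDiffOn]
  exact hV.comp ((contMDiffOn_extChartAt_symm x₀).mono inter_subset_left) inter_subset_right

theorem contDiffOn_coordRep [IsManifold (𝓡 m) ∞ M] [IsManifold (𝓡 n) ∞ N] (x₀ : M) (y₀ : N)
    {f : M → N} (hf : ContMDiff (𝓡 m) (𝓡 n) ∞ f) :
    ContDiffOn ℝ ∞ (coordRep (m := m) (n := n) x₀ y₀ f)
      (coordDomain m x₀ (f ⁻¹' (extChartAt (𝓡 n) y₀).source)) := by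
  have h : ContMDiffOn (𝓡 m) 𝓘(ℝ, EuclideanSpace ℝ (Fin n)) ∞ (extChartAt (𝓡 n) y₀ ∘ f)
      (f ⁻¹' (extChartAt (𝓡 n) y₀).source) := by
    refine (contMDiffOn_extChartAt (x := y₀)).comp hf.contMDiffOn ?_
    rw [extChartAt_source]
  exact contDiffOn_comp_extChartAt_symm x₀ h

/-- The chain rule: the Fréchet derivative of the coordinate expression is the matrix of `df` in the
two coordinate frames. -/
theorem fderiv_coordRep [IsManifold (𝓡 m) ∞ M] [IsManifold (𝓡 n) ∞ N] {x₀ x : M} {y₀ : N}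
    {f : M → N} (hx : x ∈ (extChartAt (𝓡 m) x₀).source) (hfx : f x ∈ (extChartAt (𝓡 n) y₀).source)
    (hf : MDifferentiableAt (𝓡 m) (𝓡 n) f x) (v : EuclideanSpace ℝ (Fin m)) :
    chartFrame y₀ (f x) (fderiv ℝ (coordRep x₀ y₀ f) (extChartAt (𝓡 m) x₀ x) v) =
      mfderiv (𝓡 m) (𝓡 n) f x (chartFrame x₀ x v) := by
  have : IsManifold (𝓡 n) 1 N := .of_le (n := ∞) (by simp)
  have : IsManifold (𝓡 m) 1 M := .of_le (n := ∞) (by simp)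
  set u := extChartAt (𝓡 m) x₀ x with hu
  have hux : (extChartAt (𝓡 m) x₀).symm u = x := (extChartAt (𝓡 m) x₀).left_inv hx
  have h1 : HasMFDerivAt 𝓘(ℝ, EuclideanSpace ℝ (Fin m)) (𝓡 m) (extChartAt (𝓡 m) x₀).symm u
      (mfderiv 𝓘(ℝ, EuclideanSpace ℝ (Fin m)) (𝓡 m) (extChartAt (𝓡 m) x₀).symm u) := by
    refine MDifferentiableAt.hasMFDerivAt ?_
    exact (contMDiffOn_extChartAt_symm (n := 1) x₀).contMDiffAt ((isOpen_extChartAt_target x₀).mem_nhds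
      ((extChartAt (𝓡 m) x₀).map_source hx)) |>.mdifferentiableAt (by simp)
  have h2 : HasMFDerivAt (𝓡 m) (𝓡 n) f ((extChartAt (𝓡 m) x₀).symm u)
      (mfderiv (𝓡 m) (𝓡 n) f x) := by rw [hux]; exact hf.hasMFDerivAt
  have h3 : HasMFDerivAt (𝓡 n) 𝓘(ℝ, EuclideanSpace ℝ (Fin n)) (extChartAt (𝓡 n) y₀)
      (f ((extChartAt (𝓡 m) x₀).symm u))
      (mfderiv (𝓡 n) 𝓘(ℝ, EuclideanSpace ℝ (Fin n)) (extChartAt (𝓡 n) y₀) (f x)) := by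
    rw [hux]
    rw [extChartAt_source] at hfx
    exact (mdifferentiableAt_extChartAt hfx).hasMFDerivAt
  have h4 := h3.comp u (h2.comp u h1)
  have h5 : fderiv ℝ (coordRep x₀ y₀ f) u v =
      mfderiv (𝓡 n) 𝓘(ℝ, EuclideanSpace ℝ (Fin n)) (extChartAt (𝓡 n) y₀) (f x)
        (mfderiv (𝓡 m) (𝓡 n) f x (chartFrame x₀ x v)) := by
    let G : EuclideanSpace ℝ (Fin m) →L[ℝ] EuclideanSpace ℝ (Fin n) :=
      (mfderiv (𝓡 n) 𝓘(ℝ, EuclideanSpace ℝ (Fin n)) (extChartAt (𝓡 n) y₀) (f x)).comp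
        ((mfderiv (𝓡 m) (𝓡 n) f x).comp (chartFrame x₀ x))
    have h6 : HasFDerivAt (coordRep x₀ y₀ f) G u := h4.hasFDerivAt
    rw [h6.fderiv]
    rfl
  rw [h5, chartFrame_mfderiv_extChartAt hfx]

theorem formComponents_pullback [IsManifold (𝓡 m) ∞ M] [IsManifold (𝓡 n) ∞ N]
    (Ω : SymplecticForm n N) {x₀ x : M} {y₀ : N} {f : M → N}
    (hx : x ∈ (extChartAt (𝓡 m) x₀).source) (hfx : f x ∈ (extChartAt (𝓡 n) y₀).source)
    (hf : MDifferentiableAt (𝓡 m) (𝓡 n) f x) (i j : Fin m) :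
    formComponents x₀ x (Ω.pullback m f x) i j =
      pullForm (Ω.curried y₀) (coordRep x₀ y₀ f) (extChartAt (𝓡 m) x₀ x)
        (EuclideanSpace.single i 1) (EuclideanSpace.single j 1) := by
  have hr : coordRep x₀ y₀ f (extChartAt (𝓡 m) x₀ x) = extChartAt (𝓡 n) y₀ (f x) := by
    rw [coordRep, (extChartAt (𝓡 m) x₀).left_inv hx]
  rw [pullForm, hr, Ω.curried_apply_chart hfx, fderiv_coordRep hx hfx hf,
    fderiv_coordRep hx hfx hf]
  simp only [formComponents, SymplecticForm.pullback, Matrix.of_apply]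
  rw [ContinuousAlternatingMap.compContinuousLinearMap_apply]
  congr 1
  funext k
  fin_cases k <;> rfl

end Charts

/-! ### Straight-line variations inside a chart -/

section Variation

open Filter Topology

set_option maxSynthPendingDepth 3

variable {m n : ℕ}
  {M : Type*} [TopologicalSpace M] [ChartedSpace (EuclideanSpace ℝ (Fin m)) M]
  {N : Type*} [TopologicalSpace N] [ChartedSpace (EuclideanSpace ℝ (Fin n)) N]

open Classical in
/-- The map `f`, moved by `t V` in the chart around `y₀`. -/
def vary (f : M → N) (y₀ : N) (V : M → EuclideanSpace ℝ (Fin n)) (t : ℝ) (x : M) : N :=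
  if f x ∈ (extChartAt (𝓡 n) y₀).source then
    (extChartAt (𝓡 n) y₀).symm (extChartAt (𝓡 n) y₀ (f x) + t • V x) else f x

/-- The times at which `vary f y₀ V` stays in the chart around `y₀`. -/
def varyTimes (f : M → N) (y₀ : N) (V : M → EuclideanSpace ℝ (Fin n)) : Set ℝ :=
  {t | ∀ x ∈ tsupport V, extChartAt (𝓡 n) y₀ (f x) + t • V x ∈ (extChartAt (𝓡 n) y₀).target}

omit [TopologicalSpace M] in
theorem vary_of_mem {f : M → N} {y₀ : N} {V : M → EuclideanSpace ℝ (Fin n)} {t : ℝ} {x : M}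
    (hx : f x ∈ (extChartAt (𝓡 n) y₀).source) : vary f y₀ V t x =
      (extChartAt (𝓡 n) y₀).symm (extChartAt (𝓡 n) y₀ (f x) + t • V x) := if_pos hx

omit [TopologicalSpace M] in
theorem vary_of_eq_zero {f : M → N} {y₀ : N} {V : M → EuclideanSpace ℝ (Fin n)} {t : ℝ} {x : M}
    (hx : V x = 0) : vary f y₀ V t x = f x := by
  unfold vary
  split_ifs with h
  · rw [hx, smul_zero, add_zero, (extChartAt (𝓡 n) y₀).left_inv h]
  · rfl

omit [TopologicalSpace M] in
theorem vary_zero (f : M → N) (y₀ : N) (V : M → EuclideanSpace ℝ (Fin n)) : vary f y₀ V 0 = f := by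
  funext x
  unfold vary
  split_ifs with h
  · rw [zero_smul, add_zero, (extChartAt (𝓡 n) y₀).left_inv h]
  · rfl

theorem eq_zero_near_of_notMem_tsupport {F : Type*} [Zero F] {V : M → F} {x : M}
    (hx : x ∉ tsupport V) : ∀ᶠ y in 𝓝 x, V y = 0 := by
  filter_upwards [(isClosed_tsupport V).isOpen_compl.mem_nhds hx] with y hy
  exact image_eq_zero_of_notMem_tsupport hy

theorem zero_mem_varyTimes {f : M → N} {y₀ : N} {V : M → EuclideanSpace ℝ (Fin n)}
    (hV : tsupport V ⊆ f ⁻¹' (extChartAt (𝓡 n) y₀).source) : 0 ∈ varyTimes f y₀ V := by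
  intro x hx
  rw [zero_smul, add_zero]
  exact (extChartAt (𝓡 n) y₀).map_source (hV hx)

theorem mem_target_of_mem_varyTimes {f : M → N} {y₀ : N} {V : M → EuclideanSpace ℝ (Fin n)} {t : ℝ}
    {x : M} (ht : t ∈ varyTimes f y₀ V) (hx : f x ∈ (extChartAt (𝓡 n) y₀).source) :
    extChartAt (𝓡 n) y₀ (f x) + t • V x ∈ (extChartAt (𝓡 n) y₀).target := by
  by_cases h : x ∈ tsupport V
  · exact ht x h
  · rw [image_eq_zero_of_notMem_tsupport h, smul_zero, add_zero]
    exact (extChartAt (𝓡 n) y₀).map_source hx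

/-- A tube-lemma argument: the condition is open at each point, and the support of `V` is compact.
-/
theorem isOpen_varyTimes [CompactSpace M] {f : M → N} {y₀ : N} {V : M → EuclideanSpace ℝ (Fin n)}
    (hf : Continuous f) (hVc : Continuous V)
    (hV : tsupport V ⊆ f ⁻¹' (extChartAt (𝓡 n) y₀).source) : IsOpen (varyTimes f y₀ V) := by
  rw [isOpen_iff_mem_nhds]
  intro t ht
  have : ∀ᶠ s in 𝓝 t, ∀ x ∈ tsupport V,
      extChartAt (𝓡 n) y₀ (f x) + s • V x ∈ (extChartAt (𝓡 n) y₀).target := by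
    refine (isClosed_tsupport V).isCompact.eventually_forall_of_forall_eventually fun x hx ↦ ?_
    have hc : ContinuousAt (fun z : ℝ × M ↦ extChartAt (𝓡 n) y₀ (f z.2) + z.1 • V z.2) (t, x) := by
      have h1 : ContinuousAt (fun z : ℝ × M ↦ extChartAt (𝓡 n) y₀ (f z.2)) (t, x) :=
        ContinuousAt.comp (f := fun z : ℝ × M ↦ f z.2) (continuousAt_extChartAt' (hV hx))
          (by fun_prop)
      fun_prop
    exact hc.eventually_mem ((isOpen_extChartAt_target y₀).mem_nhds (ht x hx))
  exact this

/-- The two branches of `vary` glue smoothly: a point is either mapped into the open chart domain,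
where the chart formula applies, or lies outside `tsupport V`, where the map is locally `f`. -/
theorem contMDiffOn_vary [IsManifold (𝓡 n) ∞ N] {f : M → N} {y₀ : N}
    {V : M → EuclideanSpace ℝ (Fin n)} (hf : ContMDiff (𝓡 m) (𝓡 n) ∞ f)
    (hVs : ContMDiff (𝓡 m) 𝓘(ℝ, EuclideanSpace ℝ (Fin n)) ∞ V)
    (hV : tsupport V ⊆ f ⁻¹' (extChartAt (𝓡 n) y₀).source) :
    ContMDiffOn (𝓘(ℝ, ℝ).prod (𝓡 m)) (𝓡 n) ∞ (fun p : ℝ × M ↦ vary f y₀ V p.1 p.2)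
      (varyTimes f y₀ V ×ˢ univ) := by
  rintro ⟨t, x⟩ ⟨ht, -⟩
  refine ContMDiffAt.contMDiffWithinAt ?_
  have hf2 : ContMDiff (𝓘(ℝ, ℝ).prod (𝓡 m)) (𝓡 n) ∞ (fun p : ℝ × M ↦ f p.2) :=
    hf.comp contMDiff_snd
  by_cases hx : f x ∈ (extChartAt (𝓡 n) y₀).source
  · have hev : (fun p : ℝ × M ↦ vary f y₀ V p.1 p.2) =ᶠ[𝓝 (t, x)] fun p ↦
        (extChartAt (𝓡 n) y₀).symm (extChartAt (𝓡 n) y₀ (f p.2) + p.1 • V p.2) := by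
      have : ∀ᶠ p : ℝ × M in 𝓝 (t, x), f p.2 ∈ (extChartAt (𝓡 n) y₀).source :=
        hf2.continuous.continuousAt.eventually_mem ((isOpen_extChartAt_source y₀).mem_nhds hx)
      filter_upwards [this] with p hp using vary_of_mem hp
    refine ContMDiffAt.congr_of_eventuallyEq ?_ hev
    have h1 : ContMDiffAt (𝓘(ℝ, ℝ).prod (𝓡 m)) 𝓘(ℝ, EuclideanSpace ℝ (Fin n)) ∞
        (fun p : ℝ × M ↦ extChartAt (𝓡 n) y₀ (f p.2)) (t, x) := by
      refine ContMDiffAt.comp (I' := 𝓡 n) (t, x) (g := extChartAt (𝓡 n) y₀)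
        (f := fun p : ℝ × M ↦ f p.2) ?_ (hf2 _)
      rw [extChartAt_source] at hx
      exact contMDiffAt_extChartAt' hx
    have h2 : ContMDiffAt (𝓘(ℝ, ℝ).prod (𝓡 m)) 𝓘(ℝ, EuclideanSpace ℝ (Fin n)) ∞
        (fun p : ℝ × M ↦ p.1 • V p.2) (t, x) :=
      ContMDiffAt.smul (contMDiff_fst _) ((hVs.comp contMDiff_snd) _)
    have h3 := (contMDiffOn_extChartAt_symm (I := 𝓡 n) (n := ∞) y₀).contMDiffAt
      ((isOpen_extChartAt_target y₀).mem_nhds (mem_target_of_mem_varyTimes ht hx))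
    exact ContMDiffAt.comp (t, x) (g := (extChartAt (𝓡 n) y₀).symm)
      (f := fun p : ℝ × M ↦ extChartAt (𝓡 n) y₀ (f p.2) + p.1 • V p.2) h3 (h1.add h2)
  · have hxt : x ∉ tsupport V := fun h ↦ hx (hV h)
    have hev : (fun p : ℝ × M ↦ vary f y₀ V p.1 p.2) =ᶠ[𝓝 (t, x)] fun p ↦ f p.2 := by
      have : ∀ᶠ p : ℝ × M in 𝓝 (t, x), V p.2 = 0 :=
        (continuous_snd.tendsto (t, x)).eventually (eq_zero_near_of_notMem_tsupport hxt)
      filter_upwards [this] with p hp using vary_of_eq_zero hp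
    exact (hf2 _).congr_of_eventuallyEq hev

theorem contMDiff_vary [IsManifold (𝓡 n) ∞ N] {f : M → N} {y₀ : N}
    {V : M → EuclideanSpace ℝ (Fin n)} (hf : ContMDiff (𝓡 m) (𝓡 n) ∞ f)
    (hVs : ContMDiff (𝓡 m) 𝓘(ℝ, EuclideanSpace ℝ (Fin n)) ∞ V)
    (hV : tsupport V ⊆ f ⁻¹' (extChartAt (𝓡 n) y₀).source) {t : ℝ} (ht : t ∈ varyTimes f y₀ V) :
    ContMDiff (𝓡 m) (𝓡 n) ∞ (vary f y₀ V t) := by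
  have h : ContMDiff (𝓡 m) (𝓘(ℝ, ℝ).prod (𝓡 m)) ∞ (fun x : M ↦ (t, x)) :=
    contMDiff_const.prodMk contMDiff_id
  exact (contMDiffOn_vary hf hVs hV).comp_contMDiff h fun x ↦ ⟨ht, trivial⟩

/-- The components, in the chart around `x₀`, of the derivative at time `t` of the pull-back of `Ω`
under `vary f y₀ V`. -/
def varyComponents (Ω : SymplecticForm n N) (x₀ : M) (f : M → N) (y₀ : N)
    (V : M → EuclideanSpace ℝ (Fin n)) (t : ℝ) (x : M) : Matrix (Fin m) (Fin m) ℝ :=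
  .of fun i j ↦ pullFormVar (Ω.curried y₀)
    (fun u ↦ coordRep x₀ y₀ f u + t • (V ∘ (extChartAt (𝓡 m) x₀).symm) u)
    (V ∘ (extChartAt (𝓡 m) x₀).symm) (extChartAt (𝓡 m) x₀ x)
    (EuclideanSpace.single i 1) (EuclideanSpace.single j 1)

theorem comp_extChartAt_symm_eventually {x₀ x : M} (hx : x ∈ (extChartAt (𝓡 m) x₀).source)
    {p : M → Prop} (h : ∀ᶠ y in 𝓝 x, p y) :
    ∀ᶠ u in 𝓝 (extChartAt (𝓡 m) x₀ x), p ((extChartAt (𝓡 m) x₀).symm u) := by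
  have hc := continuousAt_extChartAt_symm' (I := 𝓡 m) hx
  rw [ContinuousAt, (extChartAt (𝓡 m) x₀).left_inv hx] at hc
  exact hc.eventually h

theorem pullFormVar_of_eventually_zero {E F : Type*} [NormedAddCommGroup E] [NormedSpace ℝ E]
    [NormedAddCommGroup F] [NormedSpace ℝ F] (B : F → F →L[ℝ] F →L[ℝ] ℝ) (g : E → F) {V : E → F}
    {u : E} (h : ∀ᶠ z in 𝓝 u, V z = 0) (a b : E) : pullFormVar B g V u a b = 0 := by
  have h1 : fderiv ℝ V u = 0 := by
    rw [Filter.EventuallyEq.fderiv_eq (f₁ := V) (f := fun _ ↦ (0 : F)) h]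
    simp
  simp [pullFormVar, h1, h.self_of_nhds]

/-- Off the support, `V` vanishes on a neighbourhood, so its derivative vanishes too. This makes the
cut-off in `varyPairing` consistent with the chart formula. -/
theorem varyComponents_of_notMem (Ω : SymplecticForm n N) {x₀ x : M} (f : M → N) (y₀ : N)
    {V : M → EuclideanSpace ℝ (Fin n)} (t : ℝ) (hx : x ∈ (extChartAt (𝓡 m) x₀).source)
    (hV : x ∉ tsupport V) : varyComponents (m := m) Ω x₀ f y₀ V t x = 0 := by
  ext i j
  have h := comp_extChartAt_symm_eventually hx (eq_zero_near_of_notMem_tsupport hV)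
  simp only [varyComponents, Matrix.of_apply, Matrix.zero_apply]
  exact pullFormVar_of_eventually_zero (V := V ∘ (extChartAt (𝓡 m) x₀).symm) _ _ h _ _

theorem coordRep_vary_eventuallyEq [IsManifold (𝓡 n) ∞ N] {x₀ x : M} {f : M → N} {y₀ : N}
    {V : M → EuclideanSpace ℝ (Fin n)} (hf : Continuous f) {t : ℝ} (ht : t ∈ varyTimes f y₀ V)
    (hx : x ∈ (extChartAt (𝓡 m) x₀).source) (hfx : f x ∈ (extChartAt (𝓡 n) y₀).source) :
    coordRep x₀ y₀ (vary f y₀ V t) =ᶠ[𝓝 (extChartAt (𝓡 m) x₀ x)]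
      fun u ↦ coordRep x₀ y₀ f u + t • (V ∘ (extChartAt (𝓡 m) x₀).symm) u := by
  have : ∀ᶠ y in 𝓝 x, f y ∈ (extChartAt (𝓡 n) y₀).source :=
    hf.continuousAt.eventually_mem ((isOpen_extChartAt_source y₀).mem_nhds hfx)
  filter_upwards [comp_extChartAt_symm_eventually hx this] with u hu
  simp only [coordRep, Function.comp_apply]
  rw [vary_of_mem hu, (extChartAt (𝓡 n) y₀).right_inv (mem_target_of_mem_varyTimes ht hu)]

theorem pullForm_congr {E F : Type*} [NormedAddCommGroup E] [NormedSpace ℝ E]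
    [NormedAddCommGroup F] [NormedSpace ℝ F] (B : F → F →L[ℝ] F →L[ℝ] ℝ) {g g' : E → F}
    {u : E} (h : g =ᶠ[𝓝 u] g') (a b : E) : pullForm B g u a b = pullForm B g' u a b := by
  rw [pullForm, pullForm, h.fderiv_eq, h.eq_of_nhds]

theorem vary_mem_source {f : M → N} {y₀ : N} {V : M → EuclideanSpace ℝ (Fin n)} {t : ℝ}
    {x : M} (ht : t ∈ varyTimes f y₀ V) (hx : f x ∈ (extChartAt (𝓡 n) y₀).source) :
    vary f y₀ V t x ∈ (extChartAt (𝓡 n) y₀).source := by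
  rw [vary_of_mem hx]
  exact (extChartAt (𝓡 n) y₀).map_target (mem_target_of_mem_varyTimes ht hx)

theorem formComponents_pullback_vary [IsManifold (𝓡 m) ∞ M] [IsManifold (𝓡 n) ∞ N]
    (Ω : SymplecticForm n N) {x₀ x : M} {f : M → N} {y₀ : N} {V : M → EuclideanSpace ℝ (Fin n)}
    (hf : ContMDiff (𝓡 m) (𝓡 n) ∞ f)
    (hVs : ContMDiff (𝓡 m) 𝓘(ℝ, EuclideanSpace ℝ (Fin n)) ∞ V)
    (hV : tsupport V ⊆ f ⁻¹' (extChartAt (𝓡 n) y₀).source) {t : ℝ} (ht : t ∈ varyTimes f y₀ V)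
    (hx : x ∈ (extChartAt (𝓡 m) x₀).source) (hfx : f x ∈ (extChartAt (𝓡 n) y₀).source)
    (i j : Fin m) :
    formComponents x₀ x (Ω.pullback m (vary f y₀ V t) x) i j = pullForm (Ω.curried y₀)
      (fun u ↦ coordRep x₀ y₀ f u + t • (V ∘ (extChartAt (𝓡 m) x₀).symm) u)
      (extChartAt (𝓡 m) x₀ x) (EuclideanSpace.single i 1) (EuclideanSpace.single j 1) := by
  rw [formComponents_pullback Ω hx (vary_mem_source ht hfx)
    ((contMDiff_vary hf hVs hV ht).mdifferentiable (by simp) x),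
    pullForm_congr _ (coordRep_vary_eventuallyEq hf.continuous ht hx hfx)]

theorem hasDerivAt_formComponents_vary [IsManifold (𝓡 m) ∞ M] [IsManifold (𝓡 n) ∞ N] [CompactSpace M]
    (Ω : SymplecticForm n N) {x₀ x : M} {f : M → N} {y₀ : N} {V : M → EuclideanSpace ℝ (Fin n)}
    (hf : ContMDiff (𝓡 m) (𝓡 n) ∞ f)
    (hVs : ContMDiff (𝓡 m) 𝓘(ℝ, EuclideanSpace ℝ (Fin n)) ∞ V)
    (hV : tsupport V ⊆ f ⁻¹' (extChartAt (𝓡 n) y₀).source) {t : ℝ} (ht : t ∈ varyTimes f y₀ V)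
    (hx : x ∈ (extChartAt (𝓡 m) x₀).source) (hfx : f x ∈ (extChartAt (𝓡 n) y₀).source)
    (i j : Fin m) :
    HasDerivAt (fun t ↦ formComponents x₀ x (Ω.pullback m (vary f y₀ V t) x) i j)
      (varyComponents Ω x₀ f y₀ V t x i j) t := by
  have hev : (fun t ↦ formComponents x₀ x (Ω.pullback m (vary f y₀ V t) x) i j) =ᶠ[𝓝 t]
      fun t ↦ pullForm (Ω.curried y₀)
        (fun u ↦ coordRep x₀ y₀ f u + t • (V ∘ (extChartAt (𝓡 m) x₀).symm) u)
        (extChartAt (𝓡 m) x₀ x) (EuclideanSpace.single i 1) (EuclideanSpace.single j 1) := by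
    filter_upwards [(isOpen_varyTimes hf.continuous hVs.continuous hV).mem_nhds ht] with s hs
    exact formComponents_pullback_vary Ω hf hVs hV hs hx hfx i j
  refine HasDerivAt.congr_of_eventuallyEq ?_ hev
  have hu : extChartAt (𝓡 m) x₀ x ∈ coordDomain m x₀ (f ⁻¹' (extChartAt (𝓡 n) y₀).source) :=
    mem_coordDomain hx hfx
  have hO := isOpen_coordDomain (m := m) x₀
    ((isOpen_extChartAt_source (I := 𝓡 n) y₀).preimage hf.continuous)
  refine hasDerivAt_pullForm ?_ ?_ ?_ _ _
  · refine ((Ω.contDiffOn_curried y₀).contDiffAt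
      ((isOpen_extChartAt_target y₀).mem_nhds ?_)).differentiableAt (by simp)
    simp only [coordRep, Function.comp_apply, (extChartAt (𝓡 m) x₀).left_inv hx]
    exact mem_target_of_mem_varyTimes ht hfx
  · exact ((contDiffOn_coordRep x₀ y₀ hf).contDiffAt (hO.mem_nhds hu)).differentiableAt (by simp)
  · exact ((contDiffOn_comp_extChartAt_symm x₀ hVs.contMDiffOn).contDiffAt
      (hO.mem_nhds hu)).differentiableAt (by simp)

theorem continuousOn_varyComponents [IsManifold (𝓡 m) ∞ M] [IsManifold (𝓡 n) ∞ N]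
    (Ω : SymplecticForm n N) (x₀ : M) {f : M → N} {y₀ : N} {V : M → EuclideanSpace ℝ (Fin n)}
    (hf : ContMDiff (𝓡 m) (𝓡 n) ∞ f)
    (hVs : ContMDiff (𝓡 m) 𝓘(ℝ, EuclideanSpace ℝ (Fin n)) ∞ V) :
    ContinuousOn (fun p : ℝ × M ↦ varyComponents (m := m) Ω x₀ f y₀ V p.1 p.2)
      (varyTimes f y₀ V ×ˢ
        ((extChartAt (𝓡 m) x₀).source ∩ f ⁻¹' (extChartAt (𝓡 n) y₀).source)) := by
  refine continuousOn_pi.2 fun i ↦ continuousOn_pi.2 fun j ↦ ?_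
  have hO := isOpen_coordDomain (m := m) x₀
    ((isOpen_extChartAt_source (I := 𝓡 n) y₀).preimage hf.continuous)
  have h := continuousOn_pullFormVar hO (isOpen_extChartAt_target y₀)
    ((Ω.contDiffOn_curried y₀).of_le (by simp)) ((contDiffOn_coordRep x₀ y₀ hf).of_le (by simp))
    ((contDiffOn_comp_extChartAt_symm x₀ hVs.contMDiffOn).of_le (by simp))
    (EuclideanSpace.single i 1) (EuclideanSpace.single j 1)
  have hc : ContinuousOn (fun p : ℝ × M ↦ (p.1, extChartAt (𝓡 m) x₀ p.2)) (varyTimes f y₀ V ×ˢ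
        ((extChartAt (𝓡 m) x₀).source ∩ f ⁻¹' (extChartAt (𝓡 n) y₀).source)) :=
    continuousOn_fst.prodMk ((continuousOn_extChartAt x₀).comp continuousOn_snd
      fun p hp ↦ hp.2.1)
  refine (h.comp hc ?_).congr fun p hp ↦ ?_
  · rintro ⟨t, x⟩ ⟨ht, hx, hfx⟩
    refine ⟨mem_coordDomain hx hfx, ?_⟩
    simp only [coordRep, Function.comp_apply, (extChartAt (𝓡 m) x₀).left_inv hx]
    exact mem_target_of_mem_varyTimes ht hfx
  · simp only [varyComponents, Matrix.of_apply, Function.comp_def]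

theorem continuousOn_formComponents_pullback [IsManifold (𝓡 m) ∞ M] [IsManifold (𝓡 n) ∞ N]
    (Ω : SymplecticForm n N) (x₀ : M) (y₀ : N) {f : M → N} (hf : ContMDiff (𝓡 m) (𝓡 n) ∞ f) :
    ContinuousOn (fun x ↦ formComponents x₀ x (Ω.pullback m f x))
      ((extChartAt (𝓡 m) x₀).source ∩ f ⁻¹' (extChartAt (𝓡 n) y₀).source) := by
  refine continuousOn_pi.2 fun i ↦ continuousOn_pi.2 fun j ↦ ?_
  have hO := isOpen_coordDomain (m := m) x₀
    ((isOpen_extChartAt_source (I := 𝓡 n) y₀).preimage hf.continuous)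
  have h := continuousOn_pullForm hO (Ω.contDiffOn_curried y₀).continuousOn
    ((contDiffOn_coordRep x₀ y₀ hf).of_le (by simp))
    (fun u hu ↦ (extChartAt (𝓡 n) y₀).map_source hu.2)
    (EuclideanSpace.single i 1) (EuclideanSpace.single j 1)
  refine ContinuousOn.congr (h.comp ((continuousOn_extChartAt x₀).mono inter_subset_left)
    fun x hx ↦ mem_coordDomain hx.1 hx.2) fun x hx ↦ ?_
  exact formComponents_pullback Ω hx.1 hx.2 (hf.mdifferentiable (by simp) x) i j

theorem continuousOn_formComponents_pullback_source [IsManifold (𝓡 m) ∞ M] [IsManifold (𝓡 n) ∞ N]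
    (Ω : SymplecticForm n N) (x₀ : M) {f : M → N} (hf : ContMDiff (𝓡 m) (𝓡 n) ∞ f) :
    ContinuousOn (fun x ↦ formComponents x₀ x (Ω.pullback m f x)) (extChartAt (𝓡 m) x₀).source := by
  intro x hx
  have hU : IsOpen ((extChartAt (𝓡 m) x₀).source ∩ f ⁻¹' (extChartAt (𝓡 n) (f x)).source) :=
    (isOpen_extChartAt_source x₀).inter ((isOpen_extChartAt_source (f x)).preimage hf.continuous)
  exact ((continuousOn_formComponents_pullback Ω x₀ (f x) hf).continuousAt
    (hU.mem_nhds ⟨hx, mem_extChartAt_source _⟩)).continuousWithinAt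

end Variation

/-! ### Differentiating the pairing under the integral -/

section FirstVariation

open Filter Topology

set_option maxSynthPendingDepth 3

/-- On a compact space, a jointly continuous derivative is bounded near `t` by a constant, which is
integrable for a finite measure. -/
theorem hasDerivAt_integral_of_continuousOn {X : Type*} [TopologicalSpace X] [CompactSpace X]
    [MeasurableSpace X] [BorelSpace X] (μ : Measure X) [IsFiniteMeasure μ] {J : Set ℝ}
    (hJ : IsOpen J) {F F' : ℝ → X → ℝ} (hF : ∀ t ∈ J, Continuous (F t))
    (hF' : ContinuousOn (fun p : ℝ × X ↦ F' p.1 p.2) (J ×ˢ univ))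
    (hd : ∀ t ∈ J, ∀ x, HasDerivAt (fun t ↦ F t x) (F' t x) t) {t : ℝ} (ht : t ∈ J) :
    HasDerivAt (fun t ↦ ∫ x, F t x ∂μ) (∫ x, F' t x ∂μ) t := by
  obtain ⟨r, hr, hrJ⟩ := Metric.nhds_basis_closedBall.mem_iff.1 (hJ.mem_nhds ht)
  obtain ⟨C, hC⟩ := ((isCompact_closedBall t r).prod (isCompact_univ (X := X))).exists_bound_of_continuousOn
    (hF'.mono (prod_mono hrJ subset_rfl))
  have hint (G : X → ℝ) (hG : Continuous G) : Integrable G μ :=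
    hG.integrable_of_hasCompactSupport (HasCompactSupport.of_compactSpace G)
  have hF't : Continuous (F' t) :=
    (hF'.comp_continuous (f := fun x : X ↦ (t, x)) (by fun_prop) fun x ↦ ⟨ht, trivial⟩)
  refine (hasDerivAt_integral_of_dominated_loc_of_deriv_le (F := F) (F' := F')
    (bound := fun _ ↦ C) (Metric.closedBall_mem_nhds t hr) ?_ (hint _ (hF t ht))
    (hint _ hF't).aestronglyMeasurable ?_ (integrable_const C) ?_).2
  · filter_upwards [hJ.mem_nhds ht] with s hs using (hint _ (hF s hs)).aestronglyMeasurable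
  · exact .of_forall fun x s hs ↦ hC (s, x) ⟨hs, trivial⟩
  · exact .of_forall fun x s hs ↦ hd s (hrJ hs) x

variable {m n : ℕ}
  {M : Type*} [TopologicalSpace M] [ChartedSpace (EuclideanSpace ℝ (Fin m)) M]
  [RiemannianBundle (fun x : M ↦ TangentSpace (𝓡 m) x)]
  {N : Type*} [TopologicalSpace N] [ChartedSpace (EuclideanSpace ℝ (Fin n)) N]

/-- Displays the pairing as linear in the entries of `B`, so that it can be differentiated
entrywise. -/
theorem chartPairing_eq_sum (x₀ x : M) (A B : Matrix (Fin m) (Fin m) ℝ) :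
    chartPairing x₀ x A B = (∑ i, ∑ j,
      ((chartGram x₀ x)⁻¹ * (A.transpose * (chartGram x₀ x)⁻¹) : Matrix (Fin m) (Fin m) ℝ) i j *
        B j i) / 2 := by
  rw [chartPairing, Matrix.trace_mul_comm, ← Matrix.mul_assoc, Matrix.trace]
  simp only [Matrix.diag_apply, Matrix.mul_apply (M := (chartGram x₀ x)⁻¹ * _) (N := B)]

theorem chartPairing_zero (x₀ x : M) (A : Matrix (Fin m) (Fin m) ℝ) :
    chartPairing x₀ x A 0 = 0 := by simp [chartPairing]

theorem hasDerivAt_chartPairing {x₀ x : M} {A : Matrix (Fin m) (Fin m) ℝ}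
    {B : ℝ → Matrix (Fin m) (Fin m) ℝ} {B' : Matrix (Fin m) (Fin m) ℝ} {t : ℝ}
    (h : ∀ i j, HasDerivAt (fun t ↦ B t i j) (B' i j) t) :
    HasDerivAt (fun t ↦ chartPairing x₀ x A (B t)) (chartPairing x₀ x A B') t := by
  simp only [chartPairing_eq_sum]
  exact (HasDerivAt.fun_sum fun i _ ↦ HasDerivAt.fun_sum fun j _ ↦ (h j i).const_mul _).div_const _

section

variable [IsManifold (𝓡 m) ∞ M] [IsManifold (𝓡 n) ∞ N]

/-- Locality: a variation does not change the integrand off the support of its field. -/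
theorem formInner_pullback_congr (Ω : SymplecticForm n N) {f g : M → N} {x : M}
    (hf : MDifferentiableAt (𝓡 m) (𝓡 n) f x) (hfg : g =ᶠ[𝓝 x] f)
    (η : TangentSpace (𝓡 m) x [⋀^Fin 2]→L[ℝ] ℝ) :
    formInner x η (Ω.pullback m g x) = formInner x η (Ω.pullback m f x) := by
  have hx := mem_extChartAt_source (I := 𝓡 m) x
  have hfx := mem_extChartAt_source (I := 𝓡 n) (f x)
  rw [formInner_eq_chartPairing hx, formInner_eq_chartPairing hx]
  congr 1
  ext i j
  rw [formComponents_pullback Ω hx (y₀ := f x) (by rwa [hfg.eq_of_nhds])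
    (hf.congr_of_eventuallyEq hfg), formComponents_pullback Ω hx hfx hf]
  refine pullForm_congr _ ?_ _ _
  filter_upwards [comp_extChartAt_symm_eventually hx hfg] with u hu
  rw [coordRep, coordRep, hu]

variable [IsContMDiffRiemannianBundle (𝓡 m) ∞ (EuclideanSpace ℝ (Fin m))
    (fun x : M ↦ TangentSpace (𝓡 m) x)]

theorem continuous_formInner_pullback (Ω : SymplecticForm n N) {f g : M → N}
    (hf : ContMDiff (𝓡 m) (𝓡 n) ∞ f) (hg : ContMDiff (𝓡 m) (𝓡 n) ∞ g) :
    Continuous fun x ↦ formInner x (Ω.pullback m f x) (Ω.pullback m g x) := by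
  rw [continuous_iff_continuousAt]
  intro x₀
  have h := continuousOn_chartPairing x₀ continuousOn_id (mapsTo_id _)
    (continuousOn_formComponents_pullback_source Ω x₀ hf)
    (continuousOn_formComponents_pullback_source Ω x₀ hg)
  exact (h.congr fun x hx ↦ formInner_eq_chartPairing hx _ _).continuousAt
    (extChartAt_source_mem_nhds x₀)

open Classical in
/-- The inner product of `φ^*Ω` with the derivative of the pull-back of `Ω` under `vary f y₀ V`, for
`V` supported in the chart around `x₀`. -/
def varyPairing (Ω : SymplecticForm n N) (φ : M → N) (x₀ : M) (f : M → N) (y₀ : N)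
    (V : M → EuclideanSpace ℝ (Fin n)) (t : ℝ) (x : M) : ℝ :=
  if x ∈ tsupport V then
    chartPairing x₀ x (formComponents x₀ x (Ω.pullback m φ x)) (varyComponents Ω x₀ f y₀ V t x)
  else 0

omit [IsManifold (𝓡 m) ∞ M] [IsManifold (𝓡 n) ∞ N]
  [IsContMDiffRiemannianBundle (𝓡 m) ∞ (EuclideanSpace ℝ (Fin m))
    (fun x : M ↦ TangentSpace (𝓡 m) x)] in
theorem varyPairing_of_mem_source (Ω : SymplecticForm n N) (φ : M → N) {x₀ x : M} (f : M → N)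
    (y₀ : N) (V : M → EuclideanSpace ℝ (Fin n)) (t : ℝ) (hx : x ∈ (extChartAt (𝓡 m) x₀).source) :
    varyPairing (m := m) Ω φ x₀ f y₀ V t x =
      chartPairing x₀ x (formComponents x₀ x (Ω.pullback m φ x))
        (varyComponents Ω x₀ f y₀ V t x) := by
  unfold varyPairing
  split_ifs with h
  · rfl
  · rw [varyComponents_of_notMem Ω f y₀ t hx h, chartPairing_zero]

theorem continuousOn_varyPairing (Ω : SymplecticForm n N) {φ : M → N} {x₀ : M} {f : M → N} {y₀ : N}
    {V : M → EuclideanSpace ℝ (Fin n)} (hφ : ContMDiff (𝓡 m) (𝓡 n) ∞ φ)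
    (hf : ContMDiff (𝓡 m) (𝓡 n) ∞ f)
    (hVs : ContMDiff (𝓡 m) 𝓘(ℝ, EuclideanSpace ℝ (Fin n)) ∞ V)
    (hV : tsupport V ⊆ (extChartAt (𝓡 m) x₀).source ∩ f ⁻¹' (extChartAt (𝓡 n) y₀).source)
    (hJ : IsOpen (varyTimes f y₀ V)) :
    ContinuousOn (fun p : ℝ × M ↦ varyPairing (m := m) Ω φ x₀ f y₀ V p.1 p.2)
      (varyTimes f y₀ V ×ˢ univ) := by
  rintro ⟨t, x⟩ ⟨ht, -⟩
  refine ContinuousAt.continuousWithinAt ?_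
  by_cases hx : x ∈ tsupport V
  · set U := (extChartAt (𝓡 m) x₀).source ∩ f ⁻¹' (extChartAt (𝓡 n) y₀).source
    have hU : IsOpen U :=
      (isOpen_extChartAt_source x₀).inter ((isOpen_extChartAt_source y₀).preimage hf.continuous)
    have h := continuousOn_chartPairing (p := Prod.snd) (s := varyTimes f y₀ V ×ˢ U) x₀
      continuousOn_snd (fun p hp ↦ hp.2.1)
      ((continuousOn_formComponents_pullback_source Ω x₀ hφ).comp continuousOn_snd
        fun p hp ↦ hp.2.1) (continuousOn_varyComponents Ω x₀ hf hVs)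
    refine (h.congr fun p hp ↦ ?_).continuousAt ((hJ.prod hU).mem_nhds ⟨ht, hV hx⟩)
    exact varyPairing_of_mem_source Ω φ f y₀ V p.1 hp.2.1
  · have hev : (fun p : ℝ × M ↦ varyPairing (m := m) Ω φ x₀ f y₀ V p.1 p.2) =ᶠ[𝓝 (t, x)]
        fun _ ↦ 0 := by
      have : ∀ᶠ p : ℝ × M in 𝓝 (t, x), p.2 ∉ tsupport V :=
        (continuous_snd.tendsto (t, x)).eventually
          ((isClosed_tsupport V).isOpen_compl.mem_nhds hx)
      filter_upwards [this] with p hp using if_neg hp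
    exact continuousAt_const.congr hev.symm

/-- On `tsupport V` the integrand is differentiated in the two charts; elsewhere it is constant in
time. -/
theorem hasDerivAt_integral_formInner_vary [T2Space M] [CompactSpace M] [MeasurableSpace M]
    [BorelSpace M] (Ω : SymplecticForm n N) {φ : M → N} {x₀ : M} {f : M → N} {y₀ : N}
    {V : M → EuclideanSpace ℝ (Fin n)} (hφ : ContMDiff (𝓡 m) (𝓡 n) ∞ φ)
    (hf : ContMDiff (𝓡 m) (𝓡 n) ∞ f)
    (hVs : ContMDiff (𝓡 m) 𝓘(ℝ, EuclideanSpace ℝ (Fin n)) ∞ V)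
    (hV : tsupport V ⊆ (extChartAt (𝓡 m) x₀).source ∩ f ⁻¹' (extChartAt (𝓡 n) y₀).source)
    {t : ℝ} (ht : t ∈ varyTimes f y₀ V) :
    HasDerivAt (fun t ↦ ∫ x, formInner x (Ω.pullback m φ x) (Ω.pullback m (vary f y₀ V t) x)
        ∂(riemannianVolume m M))
      (∫ x, varyPairing (m := m) Ω φ x₀ f y₀ V t x ∂(riemannianVolume m M)) t := by
  have := isFiniteMeasure_riemannianVolume (m := m) (M := M)
  have hV' : tsupport V ⊆ f ⁻¹' (extChartAt (𝓡 n) y₀).source := fun x hx ↦ (hV hx).2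
  have hJ := isOpen_varyTimes hf.continuous hVs.continuous hV'
  refine hasDerivAt_integral_of_continuousOn _ hJ
    (fun s hs ↦ continuous_formInner_pullback Ω hφ (contMDiff_vary hf hVs hV' hs))
    (continuousOn_varyPairing Ω hφ hf hVs hV hJ) (fun s hs x ↦ ?_) ht
  by_cases hx : x ∈ tsupport V
  · rw [varyPairing_of_mem_source Ω φ f y₀ V s (hV hx).1]
    simp only [formInner_eq_chartPairing (hV hx).1]
    exact hasDerivAt_chartPairing fun i j ↦
      hasDerivAt_formComponents_vary Ω hf hVs hV' hs (hV hx).1 (hV hx).2 i j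
  · have h (s : ℝ) : formInner x (Ω.pullback m φ x) (Ω.pullback m (vary f y₀ V s) x) =
        formInner x (Ω.pullback m φ x) (Ω.pullback m f x) := by
      refine formInner_pullback_congr Ω (hf.mdifferentiable (by simp) x) ?_ _
      filter_upwards [eq_zero_near_of_notMem_tsupport hx] with y hy using vary_of_eq_zero hy
    simp only [h, varyPairing, if_neg hx]
    exact hasDerivAt_const _ _

end

end FirstVariation

/-! ### Smoothness of inverse matrices -/

section MatrixSmooth

variable {E : Type*} [NormedAddCommGroup E] [NormedSpace ℝ E] {k : ℕ} {s : Set E} {r : WithTop ℕ∞}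

theorem contDiffOn_matrix_det {A : E → Matrix (Fin k) (Fin k) ℝ}
    (h : ∀ i j, ContDiffOn ℝ r (fun u ↦ A u i j) s) : ContDiffOn ℝ r (fun u ↦ (A u).det) s := by
  simp only [Matrix.det_apply']
  exact ContDiffOn.sum fun σ _ ↦ contDiffOn_const.mul (contDiffOn_prod fun i _ ↦ h _ _)

theorem contDiffOn_matrix_inv_apply {A : E → Matrix (Fin k) (Fin k) ℝ}
    (h : ∀ i j, ContDiffOn ℝ r (fun u ↦ A u i j) s) (hA : ∀ u ∈ s, IsUnit (A u).det)
    (i j : Fin k) : ContDiffOn ℝ r (fun u ↦ (A u)⁻¹ i j) s := by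
  simp only [Matrix.inv_def, Ring.inverse_eq_inv', Matrix.smul_apply, Matrix.adjugate_apply,
    smul_eq_mul]
  refine ((contDiffOn_matrix_det h).inv fun u hu ↦ (hA u hu).ne_zero).mul
    (contDiffOn_matrix_det fun a b ↦ ?_)
  simp only [Matrix.updateRow_apply]
  split_ifs
  · exact contDiffOn_const
  · exact h a b

end MatrixSmooth

/-! ### Realizing 1-forms as contractions along the immersion -/

section Transfer

open Filter Topology

set_option maxSynthPendingDepth 3

/-- Smooth families of injective matrices have smooth families of right inverses of the
transpose. -/
theorem exists_contDiffOn_transpose_mulVec_eq {E : Type*} [NormedAddCommGroup E] [NormedSpace ℝ E]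
    {m n : ℕ} {s : Set E} {r : WithTop ℕ∞} {A : E → Matrix (Fin n) (Fin m) ℝ} {α : E → Fin m → ℝ}
    (hA : ∀ i j, ContDiffOn ℝ r (fun u ↦ A u i j) s) (hα : ∀ i, ContDiffOn ℝ r (fun u ↦ α u i) s)
    (hinj : ∀ u ∈ s, Function.Injective (A u).mulVec) :
    ∃ V : E → Fin n → ℝ, (∀ i, ContDiffOn ℝ r (fun u ↦ V u i) s) ∧
      (∀ u ∈ s, (A u).transpose.mulVec (V u) = α u) ∧ ∀ u, α u = 0 → V u = 0 := by
  have hS (u : E) (hu : u ∈ s) : IsUnit ((A u).transpose * A u).det :=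
    (Matrix.PosDef.conjTranspose_mul_self (A u) (hinj u hu)).det_pos.ne'.isUnit
  have hSs (i j : Fin m) : ContDiffOn ℝ r (fun u ↦ ((A u).transpose * A u) i j) s := by
    simp only [Matrix.mul_apply, Matrix.transpose_apply]
    exact ContDiffOn.sum fun k _ ↦ (hA k i).mul (hA k j)
  -- The witness is the least-norm solution `A (AᵀA)⁻¹ α`; `AᵀA` is positive definite because `A` is
  -- injective. Linearity in `α` makes it vanish where `α` does.
  refine ⟨fun u ↦ (A u).mulVec (((A u).transpose * A u)⁻¹.mulVec (α u)), fun i ↦ ?_,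
    fun u hu ↦ ?_, fun u hu ↦ by simp [hu]⟩
  · simp only [Matrix.mulVec, dotProduct]
    exact ContDiffOn.sum fun k _ ↦ (hA i k).mul (ContDiffOn.sum fun l _ ↦
      (contDiffOn_matrix_inv_apply hSs hS k l).mul (hα l))
  · rw [Matrix.mulVec_mulVec, Matrix.mulVec_mulVec, Matrix.mul_nonsing_inv _ (hS u hu),
      Matrix.one_mulVec]

variable {m n : ℕ}
  {M : Type*} [TopologicalSpace M] [ChartedSpace (EuclideanSpace ℝ (Fin m)) M]
  {N : Type*} [TopologicalSpace N] [ChartedSpace (EuclideanSpace ℝ (Fin n)) N]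
  [IsManifold (𝓡 m) ∞ M] [IsManifold (𝓡 n) ∞ N]

/-- The two hypotheses meet here: nondegeneracy forces `dφ c = 0`, and then the immersion property
forces `c = 0`. -/
theorem eq_zero_of_curried_coordRep (Ω : SymplecticForm n N) {φ : M → N} {x₀ x : M} {y₀ : N}
    (hφ : ContMDiff (𝓡 m) (𝓡 n) ∞ φ) (himm : Function.Injective (mfderiv (𝓡 m) (𝓡 n) φ x))
    (hx : x ∈ (extChartAt (𝓡 m) x₀).source) (hφx : φ x ∈ (extChartAt (𝓡 n) y₀).source)
    {c : EuclideanSpace ℝ (Fin m)} (h : ∀ w, Ω.curried y₀ (coordRep x₀ y₀ φ (extChartAt (𝓡 m) x₀ x))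
      w (fderiv ℝ (coordRep x₀ y₀ φ) (extChartAt (𝓡 m) x₀ x) c) = 0) : c = 0 := by
  have hr : coordRep x₀ y₀ φ (extChartAt (𝓡 m) x₀ x) = extChartAt (𝓡 n) y₀ (φ x) := by
    rw [coordRep, (extChartAt (𝓡 m) x₀).left_inv hx]
  rw [hr] at h
  have h1 := Ω.curried_nondegenerate hφx h
  have h2 := fderiv_coordRep hx hφx (hφ.mdifferentiable (by simp) x) c
  rw [h1, map_zero] at h2
  have h3 : chartFrame x₀ x c = 0 := himm (by rw [← h2, map_zero])
  exact (chartFrame_bijective hx).1 (by rw [h3, map_zero])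

theorem contDiffOn_contractForm {E F : Type*} [NormedAddCommGroup E] [NormedSpace ℝ E]
    [NormedAddCommGroup F] [NormedSpace ℝ F] {B : F → F →L[ℝ] F →L[ℝ] ℝ} {g V : E → F} {O : Set E}
    {T : Set F} (hO : IsOpen O) (hB : ContDiffOn ℝ ∞ B T) (hg : ContDiffOn ℝ ∞ g O)
    (hgT : MapsTo g O T) (hV : ContDiffOn ℝ ∞ V O) (b : E) :
    ContDiffOn ℝ ∞ (contractForm B g V b) O := by
  exact ((hB.comp hg hgT).clm_apply hV).clm_apply
    ((hg.fderiv_of_isOpen hO (by simp)).clm_apply contDiffOn_const)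

/-- Injectivity of `c ↦ ω(·, dφ c)` makes its transpose `W ↦ ω(W, dφ ·)` surjective, smoothly in the
point. So the 1-form produced by moving `f` along `V` also comes from a field `W` along `φ`, with no
larger support. -/
theorem exists_variation_contractForm_eq (Ω : SymplecticForm n N) {φ : M → N}
    (hφ : ContMDiff (𝓡 m) (𝓡 n) ∞ φ)
    (himm : ∀ x : M, Function.Injective (mfderiv (𝓡 m) (𝓡 n) φ x)) (x₀ : M) (y₀ : N)
    {f : M → N} {y₁ : N} {V : M → EuclideanSpace ℝ (Fin n)}
    (hf : ContMDiff (𝓡 m) (𝓡 n) ∞ f) (hVs : ContMDiff (𝓡 m) 𝓘(ℝ, EuclideanSpace ℝ (Fin n)) ∞ V)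
    {t : ℝ} (ht : t ∈ varyTimes f y₁ V)
    (hV : tsupport V ⊆ (extChartAt (𝓡 m) x₀).source ∩
      (f ⁻¹' (extChartAt (𝓡 n) y₁).source ∩ φ ⁻¹' (extChartAt (𝓡 n) y₀).source)) :
    ∃ W : M → EuclideanSpace ℝ (Fin n), ContMDiff (𝓡 m) 𝓘(ℝ, EuclideanSpace ℝ (Fin n)) ∞ W ∧
      tsupport W ⊆ tsupport V ∧
      ∀ b, ∀ u ∈ coordDomain m x₀
        (f ⁻¹' (extChartAt (𝓡 n) y₁).source ∩ φ ⁻¹' (extChartAt (𝓡 n) y₀).source),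
        contractForm (Ω.curried y₀) (coordRep x₀ y₀ φ) (W ∘ (extChartAt (𝓡 m) x₀).symm)
          (EuclideanSpace.single b 1) u =
        contractForm (Ω.curried y₁)
          (fun u ↦ coordRep x₀ y₁ f u + t • (V ∘ (extChartAt (𝓡 m) x₀).symm) u)
          (V ∘ (extChartAt (𝓡 m) x₀).symm) (EuclideanSpace.single b 1) u := by
  classical
  set U := f ⁻¹' (extChartAt (𝓡 n) y₁).source ∩ φ ⁻¹' (extChartAt (𝓡 n) y₀).source
  have hU : IsOpen U := ((isOpen_extChartAt_source y₁).preimage hf.continuous).inter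
    ((isOpen_extChartAt_source y₀).preimage hφ.continuous)
  set O := coordDomain m x₀ U
  have hO : IsOpen O := isOpen_coordDomain x₀ hU
  have hφr : ContDiffOn ℝ ∞ (coordRep (m := m) (n := n) x₀ y₀ φ) O :=
    (contDiffOn_coordRep x₀ y₀ hφ).mono fun u hu ↦ ⟨hu.1, hu.2.2⟩
  have hfr : ContDiffOn ℝ ∞ (coordRep (m := m) (n := n) x₀ y₁ f) O :=
    (contDiffOn_coordRep x₀ y₁ hf).mono fun u hu ↦ ⟨hu.1, hu.2.1⟩
  have hVr : ContDiffOn ℝ ∞ (V ∘ (extChartAt (𝓡 m) x₀).symm) O :=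
    contDiffOn_comp_extChartAt_symm x₀ hVs.contMDiffOn
  let α (u : EuclideanSpace ℝ (Fin m)) (b : Fin m) : ℝ := contractForm (Ω.curried y₁)
    (fun u ↦ coordRep x₀ y₁ f u + t • (V ∘ (extChartAt (𝓡 m) x₀).symm) u)
    (V ∘ (extChartAt (𝓡 m) x₀).symm) (EuclideanSpace.single b 1) u
  have hα (b : Fin m) : ContDiffOn ℝ ∞ (fun u ↦ α u b) O := by
    have hg : ContDiffOn ℝ ∞
        (fun u ↦ coordRep x₀ y₁ f u + t • (V ∘ (extChartAt (𝓡 m) x₀).symm) u) O :=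
      hfr.add (hVr.const_smul t)
    have hgT : MapsTo (fun u ↦ coordRep x₀ y₁ f u + t • (V ∘ (extChartAt (𝓡 m) x₀).symm) u) O
        (extChartAt (𝓡 n) y₁).target := fun u hu ↦ by
      simp only [coordRep, Function.comp_apply]
      exact mem_target_of_mem_varyTimes ht hu.2.1
    exact contDiffOn_contractForm hO (Ω.contDiffOn_curried y₁) hg hgT hVr _
  -- The entries are `ω(e_k, dφ e_b)`, so `Aᵀ W = α` says `ω(W, dφ e_b) = α_b` for every `b`.
  let A (u : EuclideanSpace ℝ (Fin m)) : Matrix (Fin n) (Fin m) ℝ := .of fun k b ↦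
    contractForm (Ω.curried y₀) (coordRep x₀ y₀ φ) (fun _ ↦ EuclideanSpace.single k 1)
      (EuclideanSpace.single b 1) u
  have hA (k : Fin n) (b : Fin m) : ContDiffOn ℝ ∞ (fun u ↦ A u k b) O :=
    contDiffOn_contractForm hO (Ω.contDiffOn_curried y₀) hφr
      (fun u hu ↦ (extChartAt (𝓡 n) y₀).map_source hu.2.2) contDiffOn_const _
  have hsum {k : ℕ} (v : EuclideanSpace ℝ (Fin k)) :
      v = ∑ i, v i • EuclideanSpace.single i (1 : ℝ) := by
    have := (EuclideanSpace.basisFun (Fin k) ℝ).sum_repr v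
    simpa using this.symm
  have hinj (u) (hu : u ∈ O) : Function.Injective (A u).mulVec := by
    have hux : extChartAt (𝓡 m) x₀ ((extChartAt (𝓡 m) x₀).symm u) = u :=
      (extChartAt (𝓡 m) x₀).right_inv hu.1
    refine (injective_iff_map_eq_zero (A u).mulVecLin).2 fun c hc ↦ ?_
    have h0 : (WithLp.toLp 2 c : EuclideanSpace ℝ (Fin m)) = 0 := by
      refine eq_zero_of_curried_coordRep Ω hφ (himm _) ((extChartAt (𝓡 m) x₀).map_target hu.1)
        hu.2.2 fun w ↦ ?_
      rw [hux]
      have hk (k : Fin n) : Ω.curried y₀ (coordRep x₀ y₀ φ u) (EuclideanSpace.single k 1)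
          (fderiv ℝ (coordRep x₀ y₀ φ) u (WithLp.toLp 2 c)) = 0 := by
        have h1 := congrFun hc k
        rw [hsum (WithLp.toLp 2 c)]
        simpa [Matrix.mulVec, dotProduct, A, contractForm, mul_comm] using h1
      rw [hsum w]
      simp [hk]
    simpa using congrArg WithLp.ofLp h0
  obtain ⟨W, hW, hWα, hW0⟩ := exists_contDiffOn_transpose_mulVec_eq hA hα hinj
  let W' (u : EuclideanSpace ℝ (Fin m)) : EuclideanSpace ℝ (Fin n) := WithLp.toLp 2 (W u)
  have hW' : ContDiffOn ℝ ∞ W' O := contDiffOn_euclidean.2 hW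
  -- Extension by zero. It agrees with the chart formula on the whole chart domain, because off
  -- `tsupport V` the 1-form, and hence its solution, is zero.
  let Z (x : M) : EuclideanSpace ℝ (Fin n) :=
    if x ∈ tsupport V then W' (extChartAt (𝓡 m) x₀ x) else 0
  have hZ {x : M} (hx : x ∈ (extChartAt (𝓡 m) x₀).source) : Z x = W' (extChartAt (𝓡 m) x₀ x) := by
    simp only [Z]
    split_ifs with h
    · rfl
    · have : α (extChartAt (𝓡 m) x₀ x) = 0 := by
        have h0 : (V ∘ (extChartAt (𝓡 m) x₀).symm) (extChartAt (𝓡 m) x₀ x) = 0 := by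
          rw [Function.comp_apply, (extChartAt (𝓡 m) x₀).left_inv hx,
            image_eq_zero_of_notMem_tsupport h]
        funext b
        simp only [α, contractForm, h0, map_zero, zero_apply, Pi.zero_apply]
      rw [show W' _ = WithLp.toLp 2 (W _) from rfl, hW0 _ this, WithLp.toLp_zero]
  have hZsupp : tsupport Z ⊆ tsupport V := by
    refine closure_minimal (fun x hx ↦ ?_) (isClosed_tsupport V)
    by_contra h
    exact hx (if_neg h)
  refine ⟨Z, fun x ↦ ?_, hZsupp, fun b u hu ↦ ?_⟩
  · by_cases hx : x ∈ tsupport V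
    · have hxs := (hV hx).1
      have hev : Z =ᶠ[𝓝 x] W' ∘ extChartAt (𝓡 m) x₀ := by
        filter_upwards [(isOpen_extChartAt_source x₀).mem_nhds hxs] with y hy using hZ hy
      refine ContMDiffAt.congr_of_eventuallyEq ?_ hev
      have h1 := (hW'.contDiffAt (hO.mem_nhds (mem_coordDomain hxs (hV hx).2))).contMDiffAt
      rw [extChartAt_source] at hxs
      exact h1.comp x (contMDiffAt_extChartAt' hxs)
    · have hev : Z =ᶠ[𝓝 x] fun _ ↦ 0 := by
        filter_upwards [(isClosed_tsupport V).isOpen_compl.mem_nhds hx] with y hy using if_neg hy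
      exact contMDiffAt_const.congr_of_eventuallyEq hev
  · have hux : extChartAt (𝓡 m) x₀ ((extChartAt (𝓡 m) x₀).symm u) = u :=
      (extChartAt (𝓡 m) x₀).right_inv hu.1
    have h1 : (Z ∘ (extChartAt (𝓡 m) x₀).symm) u = W' u := by
      rw [Function.comp_apply, hZ ((extChartAt (𝓡 m) x₀).map_target hu.1), hux]
    have h2 := congrFun (hWα u hu) b
    change _ = α u b
    rw [← h2, contractForm, h1, hsum (W' u)]
    simp [Matrix.mulVec, dotProduct, A, contractForm, W', mul_comm]

end Transfer

/-! ### Criticality and invariance under local variations -/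

section Critical

open Filter Topology

set_option maxSynthPendingDepth 3

variable {m n : ℕ}
  {M : Type*} [TopologicalSpace M] [ChartedSpace (EuclideanSpace ℝ (Fin m)) M]
  [IsManifold (𝓡 m) ∞ M] [RiemannianBundle (fun x : M ↦ TangentSpace (𝓡 m) x)]
  {N : Type*} [TopologicalSpace N] [ChartedSpace (EuclideanSpace ℝ (Fin n)) N]
  [IsManifold (𝓡 n) ∞ N]

omit [RiemannianBundle (fun x : M ↦ TangentSpace (𝓡 m) x)] in
theorem varyComponents_eq_fderiv_contractForm (Ω : SymplecticForm n N) {x₀ x : M} {f : M → N}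
    {y₀ : N} {V : M → EuclideanSpace ℝ (Fin n)} (hf : ContMDiff (𝓡 m) (𝓡 n) ∞ f)
    (hVs : ContMDiff (𝓡 m) 𝓘(ℝ, EuclideanSpace ℝ (Fin n)) ∞ V) {t : ℝ}
    (ht : t ∈ varyTimes f y₀ V) (hx : x ∈ (extChartAt (𝓡 m) x₀).source)
    (hfx : f x ∈ (extChartAt (𝓡 n) y₀).source) (i j : Fin m) :
    varyComponents Ω x₀ f y₀ V t x i j =
      fderiv ℝ (contractForm (Ω.curried y₀)
        (fun u ↦ coordRep x₀ y₀ f u + t • (V ∘ (extChartAt (𝓡 m) x₀).symm) u)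
        (V ∘ (extChartAt (𝓡 m) x₀).symm) (EuclideanSpace.single j 1)) (extChartAt (𝓡 m) x₀ x)
        (EuclideanSpace.single i 1) -
      fderiv ℝ (contractForm (Ω.curried y₀)
        (fun u ↦ coordRep x₀ y₀ f u + t • (V ∘ (extChartAt (𝓡 m) x₀).symm) u)
        (V ∘ (extChartAt (𝓡 m) x₀).symm) (EuclideanSpace.single i 1)) (extChartAt (𝓡 m) x₀ x)
        (EuclideanSpace.single j 1) := by
  have hO := isOpen_coordDomain (m := m) x₀
    ((isOpen_extChartAt_source (I := 𝓡 n) y₀).preimage hf.continuous)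
  have hu := hO.mem_nhds (mem_coordDomain (U := f ⁻¹' (extChartAt (𝓡 n) y₀).source) hx hfx)
  have hV1 := (contDiffOn_comp_extChartAt_symm x₀ hVs.contMDiffOn).contDiffAt hu
  have hf1 := (contDiffOn_coordRep x₀ y₀ hf).contDiffAt hu
  have hT : coordRep x₀ y₀ f (extChartAt (𝓡 m) x₀ x) +
      t • (V ∘ (extChartAt (𝓡 m) x₀).symm) (extChartAt (𝓡 m) x₀ x) ∈
        (extChartAt (𝓡 n) y₀).target := by
    simp only [coordRep, Function.comp_apply, (extChartAt (𝓡 m) x₀).left_inv hx]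
    exact mem_target_of_mem_varyTimes ht hfx
  have hB : DifferentiableAt ℝ (Ω.curried y₀) (coordRep x₀ y₀ f (extChartAt (𝓡 m) x₀ x) +
      t • (V ∘ (extChartAt (𝓡 m) x₀).symm) (extChartAt (𝓡 m) x₀ x)) :=
    ((Ω.contDiffOn_curried y₀).contDiffAt
      ((isOpen_extChartAt_target y₀).mem_nhds hT)).differentiableAt (by simp)
  have hg : ContDiffAt ℝ 2 (fun u ↦ coordRep x₀ y₀ f u +
      t • (V ∘ (extChartAt (𝓡 m) x₀).symm) u) (extChartAt (𝓡 m) x₀ x) :=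
    ContDiffAt.of_le (hf1.add (hV1.const_smul t)) (WithTop.coe_le_coe.2 (le_top : (2 : ℕ∞) ≤ ⊤))
  exact pullFormVar_eq (g := fun u ↦ coordRep x₀ y₀ f u +
      t • (V ∘ (extChartAt (𝓡 m) x₀).symm) u) hB hg (hV1.differentiableAt (by simp))
    (Ω.curried_swap y₀) (Ω.curried_closed y₀ hT) _ _

/-- Two variations with the same contracted 1-form have the same derivative of the pulled-back form,
since that derivative is `d` of the 1-form. Thus a variation of an arbitrary `f` at time `t` is
traded for a variation of `φ` at time `0`. -/
theorem exists_varyPairing_eq (Ω : SymplecticForm n N) {φ : M → N}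
    (hφ : ContMDiff (𝓡 m) (𝓡 n) ∞ φ)
    (himm : ∀ x : M, Function.Injective (mfderiv (𝓡 m) (𝓡 n) φ x)) {x₀ : M} {y₀ : N}
    {f : M → N} {y₁ : N} {V : M → EuclideanSpace ℝ (Fin n)}
    (hf : ContMDiff (𝓡 m) (𝓡 n) ∞ f) (hVs : ContMDiff (𝓡 m) 𝓘(ℝ, EuclideanSpace ℝ (Fin n)) ∞ V)
    {t : ℝ} (ht : t ∈ varyTimes f y₁ V)
    (hV : tsupport V ⊆ (extChartAt (𝓡 m) x₀).source ∩
      (f ⁻¹' (extChartAt (𝓡 n) y₁).source ∩ φ ⁻¹' (extChartAt (𝓡 n) y₀).source)) :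
    ∃ W : M → EuclideanSpace ℝ (Fin n), ContMDiff (𝓡 m) 𝓘(ℝ, EuclideanSpace ℝ (Fin n)) ∞ W ∧
      tsupport W ⊆ (extChartAt (𝓡 m) x₀).source ∩ φ ⁻¹' (extChartAt (𝓡 n) y₀).source ∧
      ∀ x, varyPairing (m := m) Ω φ x₀ φ y₀ W 0 x = varyPairing (m := m) Ω φ x₀ f y₁ V t x := by
  obtain ⟨W, hWs, hWV, hW⟩ := exists_variation_contractForm_eq Ω hφ himm x₀ y₀ hf hVs ht hV
  have hW0 : tsupport W ⊆ (extChartAt (𝓡 m) x₀).source ∩ φ ⁻¹' (extChartAt (𝓡 n) y₀).source :=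
    fun x hx ↦ ⟨(hV (hWV hx)).1, (hV (hWV hx)).2.2⟩
  refine ⟨W, hWs, hW0, fun x ↦ ?_⟩
  by_cases hx : x ∈ tsupport V
  · obtain ⟨hxs, hfx, hφx⟩ := hV hx
    rw [varyPairing_of_mem_source Ω φ φ y₀ W 0 hxs, varyPairing_of_mem_source Ω φ f y₁ V t hxs]
    congr 1
    ext i j
    rw [varyComponents_eq_fderiv_contractForm Ω hφ hWs
      (zero_mem_varyTimes fun x hx ↦ (hW0 hx).2) hxs hφx,
      varyComponents_eq_fderiv_contractForm Ω hf hVs ht hxs hfx]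
    have hO : IsOpen (coordDomain m x₀
        (f ⁻¹' (extChartAt (𝓡 n) y₁).source ∩ φ ⁻¹' (extChartAt (𝓡 n) y₀).source)) :=
      isOpen_coordDomain x₀ (((isOpen_extChartAt_source y₁).preimage hf.continuous).inter
        ((isOpen_extChartAt_source y₀).preimage hφ.continuous))
    have hev (b : Fin m) := Filter.eventuallyEq_of_mem
      (hO.mem_nhds (mem_coordDomain hxs ⟨hfx, hφx⟩)) (hW b)
    simp only [zero_smul, add_zero]
    rw [(hev i).fderiv_eq, (hev j).fderiv_eq]
  · rw [varyPairing, varyPairing, if_neg hx, if_neg fun h ↦ hx (hWV h)]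

variable [IsContMDiffRiemannianBundle (𝓡 m) ∞ (EuclideanSpace ℝ (Fin m))
    (fun x : M ↦ TangentSpace (𝓡 m) x)] [T2Space M] [CompactSpace M] [MeasurableSpace M]
    [BorelSpace M]

omit [IsManifold (𝓡 n) ∞ N] [IsContMDiffRiemannianBundle (𝓡 m) ∞ (EuclideanSpace ℝ (Fin m))
    (fun x : M ↦ TangentSpace (𝓡 m) x)] [BorelSpace M] in
theorem symplecticEnergy_eq (Ω : SymplecticForm n N) (f : M → N) :
    symplecticEnergy m Ω f = 1 / 2 *
      ∫ x, formInner x (Ω.pullback m f x) (Ω.pullback m f x) ∂(riemannianVolume m M) := by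
  simp only [symplecticEnergy, formInner_self]

theorem integrable_formInner_pullback (Ω : SymplecticForm n N) {f g : M → N}
    (hf : ContMDiff (𝓡 m) (𝓡 n) ∞ f) (hg : ContMDiff (𝓡 m) (𝓡 n) ∞ g) :
    Integrable (fun x ↦ formInner x (Ω.pullback m f x) (Ω.pullback m g x))
      (riemannianVolume m M) := by
  have := isFiniteMeasure_riemannianVolume (m := m) (M := M)
  exact (continuous_formInner_pullback Ω hf hg).integrable_of_hasCompactSupport
    (HasCompactSupport.of_compactSpace _)

theorem integral_formInner_le (Ω : SymplecticForm n N) {f g : M → N}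
    (hf : ContMDiff (𝓡 m) (𝓡 n) ∞ f) (hg : ContMDiff (𝓡 m) (𝓡 n) ∞ g) :
    ∫ x, formInner x (Ω.pullback m f x) (Ω.pullback m g x) ∂(riemannianVolume m M) ≤
      symplecticEnergy m Ω f + symplecticEnergy m Ω g := by
  have h : ∫ x, 2 * formInner x (Ω.pullback m f x) (Ω.pullback m g x) ∂(riemannianVolume m M) ≤
      ∫ x, (formInner x (Ω.pullback m f x) (Ω.pullback m f x) +
        formInner x (Ω.pullback m g x) (Ω.pullback m g x)) ∂(riemannianVolume m M) := by
    refine integral_mono ((integrable_formInner_pullback Ω hf hg).const_mul 2)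
      ((integrable_formInner_pullback Ω hf hf).add (integrable_formInner_pullback Ω hg hg))
      fun x ↦ ?_
    simp only [formInner_self]
    exact two_mul_formInner_le x _ _
  rw [integral_const_mul, integral_add (integrable_formInner_pullback Ω hf hf)
    (integrable_formInner_pullback Ω hg hg)] at h
  rw [symplecticEnergy_eq, symplecticEnergy_eq]
  linarith

/-- The weak Euler–Lagrange equation, obtained without computing the derivative of `F`: criticality
says that this derivative is `0`, and a minimum principle compares it with that of the pairing. -/
theorem integral_varyPairing_eq_zero (Ω : SymplecticForm n N) {φ : M → N}
    (hφ : ContMDiff (𝓡 m) (𝓡 n) ∞ φ) (hcrit : IsCriticalPoint m Ω φ) {x₀ : M} {y₀ : N}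
    {V : M → EuclideanSpace ℝ (Fin n)} (hVs : ContMDiff (𝓡 m) 𝓘(ℝ, EuclideanSpace ℝ (Fin n)) ∞ V)
    (hV : tsupport V ⊆ (extChartAt (𝓡 m) x₀).source ∩ φ ⁻¹' (extChartAt (𝓡 n) y₀).source) :
    ∫ x, varyPairing (m := m) Ω φ x₀ φ y₀ V 0 x ∂(riemannianVolume m M) = 0 := by
  have hV' : tsupport V ⊆ φ ⁻¹' (extChartAt (𝓡 n) y₀).source := fun x hx ↦ (hV hx).2
  have hJ := isOpen_varyTimes hφ.continuous hVs.continuous hV'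
  have h0 := zero_mem_varyTimes hV'
  obtain ⟨ε, hε, hεJ⟩ := Metric.isOpen_iff.1 hJ 0 h0
  rw [Real.ball_eq_Ioo, zero_sub, zero_add] at hεJ
  have hE := hcrit ε (vary φ y₀ V) hε
    ((contMDiffOn_vary hφ hVs hV').mono (prod_mono hεJ subset_rfl)) (vary_zero _ _ _)
  have hI := hasDerivAt_integral_formInner_vary Ω hφ hφ hVs hV h0
  -- By `integral_formInner_le` the difference `F(φ_t) - I(φ_t)` is at least `-F(φ)`, with equality
  -- at `t = 0`.
  have hmin : IsLocalMin (fun t ↦ symplecticEnergy m Ω (vary φ y₀ V t) -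
      ∫ x, formInner x (Ω.pullback m φ x) (Ω.pullback m (vary φ y₀ V t) x)
        ∂(riemannianVolume m M)) 0 := by
    filter_upwards [hJ.mem_nhds h0] with t ht
    have h1 := integral_formInner_le Ω hφ (contMDiff_vary hφ hVs hV' ht)
    have h2 := symplecticEnergy_eq (m := m) Ω φ
    simp only [vary_zero]
    linarith
  have := hmin.hasDerivAt_eq_zero (hE.sub hI)
  linarith

/-- The pairing has zero derivative throughout `[0, 1]`, not only at a critical map: at each time
the derivative is that of a variation of `φ`. -/
theorem integral_formInner_vary_one (Ω : SymplecticForm n N) {φ : M → N}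
    (hφ : ContMDiff (𝓡 m) (𝓡 n) ∞ φ)
    (himm : ∀ x : M, Function.Injective (mfderiv (𝓡 m) (𝓡 n) φ x))
    (hcrit : IsCriticalPoint m Ω φ) {x₀ : M} {y₀ : N}
    {f : M → N} {y₁ : N} {V : M → EuclideanSpace ℝ (Fin n)}
    (hf : ContMDiff (𝓡 m) (𝓡 n) ∞ f) (hVs : ContMDiff (𝓡 m) 𝓘(ℝ, EuclideanSpace ℝ (Fin n)) ∞ V)
    (ht : Icc 0 1 ⊆ varyTimes f y₁ V)
    (hV : tsupport V ⊆ (extChartAt (𝓡 m) x₀).source ∩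
      (f ⁻¹' (extChartAt (𝓡 n) y₁).source ∩ φ ⁻¹' (extChartAt (𝓡 n) y₀).source)) :
    ∫ x, formInner x (Ω.pullback m φ x) (Ω.pullback m (vary f y₁ V 1) x) ∂(riemannianVolume m M) =
      ∫ x, formInner x (Ω.pullback m φ x) (Ω.pullback m f x) ∂(riemannianVolume m M) := by
  have hd (t : ℝ) (h : t ∈ Icc (0 : ℝ) 1) : HasDerivAt (fun t ↦
      ∫ x, formInner x (Ω.pullback m φ x) (Ω.pullback m (vary f y₁ V t) x)
        ∂(riemannianVolume m M)) 0 t := by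
    -- The field `W` depends on the time `t`; no regularity in `t` is required.
    obtain ⟨W, hWs, hW, hWV⟩ := exists_varyPairing_eq Ω hφ himm hf hVs (ht h) hV
    have h1 := hasDerivAt_integral_formInner_vary Ω (x₀ := x₀) hφ hf hVs
      (fun x hx ↦ ⟨(hV hx).1, (hV hx).2.1⟩) (ht h)
    simp only [← hWV] at h1
    rwa [integral_varyPairing_eq_zero Ω hφ hcrit hWs hW] at h1
  have h := constant_of_has_deriv_right_zero
    (fun t ht ↦ (hd t ht).continuousAt.continuousWithinAt)
    (fun t ht ↦ (hd t (Ico_subset_Icc_self ht)).hasDerivWithinAt) 1 (by simp)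
  simpa only [vary_zero] using h

end Critical

/-! ### From local variations to continuous homotopies -/

section Homotopy

open Filter Topology

set_option maxSynthPendingDepth 3

theorem exists_forall_dist_lt_of_continuousOn {X Y : Type*} [MetricSpace X] [MetricSpace Y]
    {S C : Set X} {F : X → Y} (hS : IsOpen S) (hF : ContinuousOn F S) (hC : IsCompact C)
    (hCS : C ⊆ S) {ε : ℝ} (hε : 0 < ε) :
    ∃ δ > 0, ∀ c ∈ C, ∀ x, dist x c < δ → x ∈ S ∧ dist (F x) (F c) < ε := by
  obtain ⟨δ₁, hδ₁, h₁⟩ := hC.exists_thickening_subset_open hS hCS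
  have h₂ := hC.uniformContinuousAt_of_continuousAt F
    (fun c hc ↦ hF.continuousAt (hS.mem_nhds (hCS hc))) (Metric.dist_mem_uniformity hε)
  obtain ⟨δ₂, hδ₂, h₂⟩ := Metric.mem_uniformity_dist.1 h₂
  refine ⟨min δ₁ δ₂, lt_min hδ₁ hδ₂, fun c hc x hx ↦ ⟨h₁ (Metric.mem_thickening_iff.2
    ⟨c, hc, hx.trans_le (min_le_left _ _)⟩), ?_⟩⟩
  rw [dist_comm]
  exact h₂ (a := c) (b := x) (by rw [dist_comm]; exact hx.trans_le (min_le_right _ _)) hc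

variable {m n : ℕ}
  {M : Type*} [TopologicalSpace M] [ChartedSpace (EuclideanSpace ℝ (Fin m)) M]
  {N : Type*} [MetricSpace N] [ChartedSpace (EuclideanSpace ℝ (Fin n)) N]

variable (n) in
-- Balls in the chart are convex, so segments between coordinates near those of `h x` stay in the
-- target and map back close to `h x`. The bound `η / 2` for the point `a` leaves room for a further
-- approximation error of `η / 2`.
theorem exists_chart_segment_close {h : M → N} (hh : Continuous h) {K : Set M} (hK : IsCompact K)
    {y₁ : N} (hKs : K ⊆ h ⁻¹' (extChartAt (𝓡 n) y₁).source) {ε : ℝ} (hε : 0 < ε) :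
    ∃ η > 0, ∃ δ > 0, δ ≤ ε ∧ ∀ x ∈ K, ∀ a, dist a (h x) < δ → a ∈ (extChartAt (𝓡 n) y₁).source ∧
      dist (extChartAt (𝓡 n) y₁ a) (extChartAt (𝓡 n) y₁ (h x)) < η / 2 ∧
      ∀ u, dist u (extChartAt (𝓡 n) y₁ (h x)) < η → ∀ s ∈ Icc (0 : ℝ) 1,
        extChartAt (𝓡 n) y₁ a + s • (u - extChartAt (𝓡 n) y₁ a) ∈ (extChartAt (𝓡 n) y₁).target ∧
        dist ((extChartAt (𝓡 n) y₁).symm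
          (extChartAt (𝓡 n) y₁ a + s • (u - extChartAt (𝓡 n) y₁ a))) (h x) < ε := by
  have hc : ContinuousOn (fun x ↦ extChartAt (𝓡 n) y₁ (h x)) K :=
    (continuousOn_extChartAt y₁).comp hh.continuousOn hKs
  obtain ⟨η, hη, h₁⟩ := exists_forall_dist_lt_of_continuousOn (isOpen_extChartAt_target (I := 𝓡 n) y₁)
    (continuousOn_extChartAt_symm y₁) (hK.image_of_continuousOn hc) (by
      rintro _ ⟨x, hx, rfl⟩
      exact (extChartAt (𝓡 n) y₁).map_source (hKs hx)) hε
  obtain ⟨δ, hδ, h₂⟩ := exists_forall_dist_lt_of_continuousOn (isOpen_extChartAt_source (I := 𝓡 n) y₁)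
    (continuousOn_extChartAt y₁) (hK.image hh) (by
      rintro _ ⟨x, hx, rfl⟩
      exact hKs hx) (half_pos hη)
  refine ⟨η, hη, min δ ε, lt_min hδ hε, min_le_right _ _, fun x hx a ha ↦ ?_⟩
  obtain ⟨ha₁, ha₂⟩ := h₂ (h x) (mem_image_of_mem h hx) a (ha.trans_le (min_le_left _ _))
  refine ⟨ha₁, ha₂, fun u hu s hs ↦ ?_⟩
  have hmem : extChartAt (𝓡 n) y₁ a + s • (u - extChartAt (𝓡 n) y₁ a) ∈
      Metric.ball (extChartAt (𝓡 n) y₁ (h x)) η := by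
    refine (convex_ball _ _).add_smul_sub_mem ?_ hu hs
    exact ha₂.trans (half_lt_self hη)
  obtain ⟨h₃, h₄⟩ := h₁ _ (mem_image_of_mem (fun x ↦ extChartAt (𝓡 n) y₁ (h x)) hx) _ hmem
  rw [(extChartAt (𝓡 n) y₁).left_inv (hKs hx)] at h₄
  exact ⟨h₃, h₄⟩

/-- The displacement that moves `f` to `(extChartAt y₁).symm ∘ g` where the cut-off `ρ` is `1`. -/
def blendField (ρ : M → ℝ) (f : M → N) (y₁ : N) (g : M → EuclideanSpace ℝ (Fin n)) (x : M) :
    EuclideanSpace ℝ (Fin n) :=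
  ρ x • (g x - extChartAt (𝓡 n) y₁ (f x))

omit [ChartedSpace (EuclideanSpace ℝ (Fin m)) M] in
theorem tsupport_blendField (ρ : M → ℝ) (f : M → N) (y₁ : N) (g : M → EuclideanSpace ℝ (Fin n)) :
    tsupport (blendField ρ f y₁ g) ⊆ tsupport ρ :=
  closure_mono fun x hx h ↦ hx (by rw [blendField, h, zero_smul])

theorem contMDiffAt_blendField [IsManifold (𝓡 n) ∞ N] {ρ : M → ℝ} {f : M → N} {y₁ : N}
    {g : M → EuclideanSpace ℝ (Fin n)} {x : M} (hρ : ContMDiffAt (𝓡 m) 𝓘(ℝ, ℝ) ∞ ρ x)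
    (hf : ContMDiffAt (𝓡 m) (𝓡 n) ∞ f x)
    (hg : ContMDiffAt (𝓡 m) 𝓘(ℝ, EuclideanSpace ℝ (Fin n)) ∞ g x)
    (hfx : f x ∈ (extChartAt (𝓡 n) y₁).source) :
    ContMDiffAt (𝓡 m) 𝓘(ℝ, EuclideanSpace ℝ (Fin n)) ∞ (blendField ρ f y₁ g) x := by
  rw [extChartAt_source] at hfx
  exact hρ.smul (hg.sub ((contMDiffAt_extChartAt' hfx).comp x hf))

theorem contMDiff_blendField [IsManifold (𝓡 n) ∞ N] {ρ : M → ℝ} {f : M → N} {y₁ : N}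
    {g : M → EuclideanSpace ℝ (Fin n)} (hρ : ContMDiff (𝓡 m) 𝓘(ℝ, ℝ) ∞ ρ)
    (hf : ContMDiff (𝓡 m) (𝓡 n) ∞ f)
    (hg : ∀ x ∈ tsupport ρ, ContMDiffAt (𝓡 m) 𝓘(ℝ, EuclideanSpace ℝ (Fin n)) ∞ g x)
    (hfx : tsupport ρ ⊆ f ⁻¹' (extChartAt (𝓡 n) y₁).source) :
    ContMDiff (𝓡 m) 𝓘(ℝ, EuclideanSpace ℝ (Fin n)) ∞ (blendField ρ f y₁ g) := by
  intro x
  by_cases hx : x ∈ tsupport ρ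
  · exact contMDiffAt_blendField (hρ x) (hf x) (hg x hx) (hfx hx)
  · have hev : blendField ρ f y₁ g =ᶠ[𝓝 x] fun _ ↦ 0 := by
      filter_upwards [eq_zero_near_of_notMem_tsupport hx] with y hy
      rw [blendField, hy, zero_smul]
    exact contMDiffAt_const.congr_of_eventuallyEq hev

omit [ChartedSpace (EuclideanSpace ℝ (Fin m)) M] in
theorem vary_blendField_of_notMem {ρ : M → ℝ} {f : M → N} {y₁ : N}
    {g : M → EuclideanSpace ℝ (Fin n)} {x : M} (hx : x ∉ tsupport ρ) :
    vary f y₁ (blendField ρ f y₁ g) 1 =ᶠ[𝓝 x] f := by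
  filter_upwards [eq_zero_near_of_notMem_tsupport hx] with y hy
  refine vary_of_eq_zero ?_
  rw [blendField, hy, zero_smul]

/-- Interpolating in the chart with weight `ρ` moves `f` onto `f'` where `ρ = 1` and leaves every
point of earlier agreement untouched, so successive patches do not spoil one another. -/
theorem exists_blend_toward [IsManifold (𝓡 n) ∞ N] [CompactSpace M] {h : M → N} (hh : Continuous h)
    {ρ : M → ℝ} (hρ : ContMDiff (𝓡 m) 𝓘(ℝ, ℝ) ∞ ρ) (hρ01 : ∀ x, ρ x ∈ Icc (0 : ℝ) 1) {y₁ : N}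
    (hs : tsupport ρ ⊆ h ⁻¹' (extChartAt (𝓡 n) y₁).source) {ε : ℝ} (hε : 0 < ε) :
    ∃ δ > 0, δ ≤ ε ∧ ∀ f f' : M → N, ContMDiff (𝓡 m) (𝓡 n) ∞ f → ContMDiff (𝓡 m) (𝓡 n) ∞ f' →
      (∀ x, dist (f x) (h x) < δ) → (∀ x, dist (f' x) (h x) < δ) →
      ∃ V : M → EuclideanSpace ℝ (Fin n), ContMDiff (𝓡 m) 𝓘(ℝ, EuclideanSpace ℝ (Fin n)) ∞ V ∧
        tsupport V ⊆ tsupport ρ ∧ tsupport ρ ⊆ f ⁻¹' (extChartAt (𝓡 n) y₁).source ∧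
        Icc 0 1 ⊆ varyTimes f y₁ V ∧ (∀ x, dist (vary f y₁ V 1 x) (h x) < ε) ∧
        (∀ x, f x = f' x → vary f y₁ V 1 x = f' x) ∧ ∀ x, ρ x = 1 → vary f y₁ V 1 x = f' x := by
  obtain ⟨η, hη, δ, hδ, hδε, key⟩ :=
    exists_chart_segment_close n hh (isClosed_tsupport ρ).isCompact hs hε
  refine ⟨δ, hδ, hδε, fun f f' hf hf' hfh hfh' ↦ ?_⟩
  set g : M → EuclideanSpace ℝ (Fin n) := fun x ↦ extChartAt (𝓡 n) y₁ (f' x)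
  have hfs : tsupport ρ ⊆ f ⁻¹' (extChartAt (𝓡 n) y₁).source :=
    fun x hx ↦ (key x hx (f x) (hfh x)).1
  have hfs' : tsupport ρ ⊆ f' ⁻¹' (extChartAt (𝓡 n) y₁).source :=
    fun x hx ↦ (key x hx (f' x) (hfh' x)).1
  have hg (x) (hx : x ∈ tsupport ρ) :
      ContMDiffAt (𝓡 m) 𝓘(ℝ, EuclideanSpace ℝ (Fin n)) ∞ g x := by
    have h1 := hfs' hx
    rw [mem_preimage, extChartAt_source] at h1
    exact (contMDiffAt_extChartAt' h1).comp x (hf' x)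
  have hseg (x) (hx : x ∈ tsupport ρ) := (key x hx (f x) (hfh x)).2.2 (g x)
    ((key x hx (f' x) (hfh' x)).2.1.trans (half_lt_self hη))
  refine ⟨blendField ρ f y₁ g, contMDiff_blendField hρ hf hg hfs, tsupport_blendField _ _ _ _, hfs,
    fun t ht x hx ↦ ?_, fun x ↦ ?_, fun x hx ↦ ?_, fun x hx ↦ ?_⟩
  · rw [blendField, smul_smul]
    exact (hseg x (tsupport_blendField _ _ _ _ hx) (t * ρ x)
      ⟨mul_nonneg ht.1 (hρ01 x).1, mul_le_one₀ ht.2 (hρ01 x).1 (hρ01 x).2⟩).1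
  · by_cases hx : x ∈ tsupport ρ
    · rw [vary_of_mem (hfs hx), one_smul]
      exact (hseg x hx (ρ x) (hρ01 x)).2
    · rw [(vary_blendField_of_notMem hx).self_of_nhds]
      exact (hfh x).trans_le hδε
  · have : blendField ρ f y₁ g x = 0 := by simp only [blendField, g, hx, sub_self, smul_zero]
    rw [vary_of_eq_zero this, hx]
  · have hxs : x ∈ tsupport ρ := subset_tsupport ρ (by simp [hx])
    rw [vary_of_mem (hfs hxs), one_smul, blendField, hx, one_smul, add_sub_cancel]
    exact (extChartAt (𝓡 n) y₁).left_inv (hfs' hxs)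

/-- Smoothing on one patch: the coordinates of `f` are blended with a smooth approximation `g`.
Points where `f` is already smooth stay smooth, so patches can be treated one after another. -/
theorem exists_blend_smooth [IsManifold (𝓡 m) ∞ M] [IsManifold (𝓡 n) ∞ N] [CompactSpace M]
    [T2Space M] {h : M → N} (hh : Continuous h)
    {ρ : M → ℝ} (hρ : ContMDiff (𝓡 m) 𝓘(ℝ, ℝ) ∞ ρ) (hρ01 : ∀ x, ρ x ∈ Icc (0 : ℝ) 1) {y₁ : N}
    (hs : tsupport ρ ⊆ h ⁻¹' (extChartAt (𝓡 n) y₁).source) {ε : ℝ} (hε : 0 < ε) :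
    ∃ δ > 0, δ ≤ ε ∧ ∀ f : M → N, Continuous f → (∀ x, dist (f x) (h x) < δ) →
      ∃ f' : M → N, Continuous f' ∧ (∀ x, dist (f' x) (h x) < ε) ∧
        (∀ x, ContMDiffAt (𝓡 m) (𝓡 n) ∞ f x → ContMDiffAt (𝓡 m) (𝓡 n) ∞ f' x) ∧
        ∀ x, ρ =ᶠ[𝓝 x] 1 → ContMDiffAt (𝓡 m) (𝓡 n) ∞ f' x := by
  obtain ⟨η, hη, δ, hδ, hδε, key⟩ :=
    exists_chart_segment_close n hh (isClosed_tsupport ρ).isCompact hs hε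
  refine ⟨δ, hδ, hδε, fun f hf hfh ↦ ?_⟩
  have hfs : tsupport ρ ⊆ f ⁻¹' (extChartAt (𝓡 n) y₁).source :=
    fun x hx ↦ (key x hx (f x) (hfh x)).1
  have hcf (x) (hx : x ∈ tsupport ρ) : ContinuousAt (fun x ↦ extChartAt (𝓡 n) y₁ (f x)) x :=
    ContinuousAt.comp (f := f) (continuousAt_extChartAt' (hfs hx)) hf.continuousAt
  -- The constraint on `g` is void off `tsupport ρ`, where the coordinates of `f` need not make
  -- sense; this gives convex constraints on all of `M`, to be met by a partition of unity.
  obtain ⟨g, hg⟩ : ∃ g : C^∞⟮𝓡 m, M; 𝓘(ℝ, EuclideanSpace ℝ (Fin n)), EuclideanSpace ℝ (Fin n)⟯,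
      ∀ x, g x ∈ {v | x ∈ tsupport ρ → dist v (extChartAt (𝓡 n) y₁ (f x)) < η / 2} := by
    refine exists_contMDiffMap_forall_mem_convex_of_local_const (𝓡 m) (fun x ↦ ?_) fun x ↦ ?_
    · by_cases hx : x ∈ tsupport ρ
      · simp only [hx, true_imp_iff]
        exact convex_ball (extChartAt (𝓡 n) y₁ (f x)) (η / 2)
      · simpa [hx] using convex_univ
    · by_cases hx : x ∈ tsupport ρ
      · refine ⟨extChartAt (𝓡 n) y₁ (f x), ?_⟩
        filter_upwards [(hcf x hx).eventually (Metric.ball_mem_nhds _ (half_pos hη))] with y hy _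
        rwa [dist_comm]
      · refine ⟨0, ?_⟩
        filter_upwards [(isClosed_tsupport ρ).isOpen_compl.mem_nhds hx] with y hy h
        exact absurd h hy
  have hseg (x) (hx : x ∈ tsupport ρ) := (key x hx (f x) (hfh x)).2.2 (g x) (by
    linarith [dist_triangle (g x) (extChartAt (𝓡 n) y₁ (f x)) (extChartAt (𝓡 n) y₁ (h x)),
      hg x hx, (key x hx (f x) (hfh x)).2.1]) (ρ x) (hρ01 x)
  have hev (x) (hx : x ∈ tsupport ρ) : vary f y₁ (blendField ρ f y₁ g) 1 =ᶠ[𝓝 x] fun x ↦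
      (extChartAt (𝓡 n) y₁).symm (extChartAt (𝓡 n) y₁ (f x) + blendField ρ f y₁ g x) := by
    filter_upwards [hf.continuousAt.eventually_mem
      ((isOpen_extChartAt_source (I := 𝓡 n) y₁).mem_nhds (hfs hx))] with y hy
    rw [vary_of_mem hy, one_smul]
  refine ⟨vary f y₁ (blendField ρ f y₁ g) 1, ?_, fun x ↦ ?_, fun x hfx ↦ ?_, fun x hx ↦ ?_⟩
  · refine continuous_iff_continuousAt.2 fun x ↦ ?_
    by_cases hx : x ∈ tsupport ρ
    · refine ContinuousAt.congr ?_ (hev x hx).symm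
      refine ContinuousAt.comp (g := (extChartAt (𝓡 n) y₁).symm)
        (f := fun x ↦ extChartAt (𝓡 n) y₁ (f x) + blendField ρ f y₁ g x) ?_ ?_
      · exact continuousAt_extChartAt_symm'' (hseg x hx).1
      · exact (hcf x hx).add (hρ.continuous.continuousAt.smul
          (g.contMDiff.continuous.continuousAt.sub (hcf x hx)))
    · exact hf.continuousAt.congr (vary_blendField_of_notMem hx).symm
  · by_cases hx : x ∈ tsupport ρ
    · rw [(hev x hx).self_of_nhds]
      exact (hseg x hx).2
    · rw [(vary_blendField_of_notMem hx).self_of_nhds]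
      exact (hfh x).trans_le hδε
  · by_cases hx : x ∈ tsupport ρ
    · refine ContMDiffAt.congr_of_eventuallyEq ?_ (hev x hx)
      have h1 := (contMDiffOn_extChartAt_symm (I := 𝓡 n) (n := ∞) y₁).contMDiffAt
        ((isOpen_extChartAt_target y₁).mem_nhds (hseg x hx).1)
      refine ContMDiffAt.comp x (g := (extChartAt (𝓡 n) y₁).symm)
        (f := fun x ↦ extChartAt (𝓡 n) y₁ (f x) + blendField ρ f y₁ g x) h1 ?_
      have h2 := hfs hx
      rw [mem_preimage, extChartAt_source] at h2
      exact ((contMDiffAt_extChartAt' h2).comp x hfx).add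
        (contMDiffAt_blendField (hρ x) hfx (g.contMDiff x) (hfs hx))
    · exact hfx.congr_of_eventuallyEq (vary_blendField_of_notMem hx)
  · have hρx : ρ x = 1 := hx.self_of_nhds
    have hxs : x ∈ tsupport ρ := subset_tsupport ρ (by simp [hρx])
    have hev' : vary f y₁ (blendField ρ f y₁ g) 1 =ᶠ[𝓝 x] (extChartAt (𝓡 n) y₁).symm ∘ g := by
      filter_upwards [hev x hxs, hx] with y hy hy1
      rw [hy, blendField, hy1, Pi.one_apply, one_smul, add_sub_cancel, Function.comp_apply]
    refine ContMDiffAt.congr_of_eventuallyEq ?_ hev'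
    have h0 : g x ∈ (extChartAt (𝓡 n) y₁).target := by
      have := (hseg x hxs).1
      rwa [hρx, one_smul, add_sub_cancel] at this
    exact ((contMDiffOn_extChartAt_symm (I := 𝓡 n) (n := ∞) y₁).contMDiffAt
      ((isOpen_extChartAt_target y₁).mem_nhds h0)).comp x (g.contMDiff x)

/-- A compact manifold is covered by the sets where finitely many cut-off functions are `1`, with
supports subordinate to given neighbourhoods. -/
theorem exists_finset_bump_cover [T2Space M] [IsManifold (𝓡 m) ∞ M] [CompactSpace M]
    {U : M → Set M} (hU : ∀ x, U x ∈ 𝓝 x) :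
    ∃ (t : Finset M) (ρ : M → M → ℝ), (∀ x, ContMDiff (𝓡 m) 𝓘(ℝ, ℝ) ∞ (ρ x)) ∧
      (∀ x y, ρ x y ∈ Icc (0 : ℝ) 1) ∧ (∀ x, tsupport (ρ x) ⊆ U x) ∧
      ∀ z, ∃ x ∈ t, ρ x =ᶠ[𝓝 z] 1 := by
  choose ρ _ hρ using fun x ↦ (SmoothBumpFunction.nhds_basis_tsupport (I := 𝓡 m) x).mem_iff.1 (hU x)
  obtain ⟨t, -, ht⟩ := isCompact_univ.elim_nhds_subcover (fun x ↦ {z | ρ x =ᶠ[𝓝 z] 1})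
    fun x _ ↦ (ρ x).eventuallyEq_one.eventually_nhds
  refine ⟨t, fun x ↦ ρ x, fun x ↦ (ρ x).contMDiff, fun x y ↦ ⟨(ρ x).nonneg, (ρ x).le_one⟩, hρ,
    fun z ↦ ?_⟩
  simpa using ht (mem_univ z)

theorem exists_contMDiff_dist_lt [IsManifold (𝓡 m) ∞ M] [IsManifold (𝓡 n) ∞ N] [CompactSpace M]
    [T2Space M] {h : M → N} (hh : Continuous h) {ε : ℝ} (hε : 0 < ε) :
    ∃ f : M → N, ContMDiff (𝓡 m) (𝓡 n) ∞ f ∧ ∀ x, dist (f x) (h x) < ε := by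
  classical
  obtain ⟨t, ρ, hρ, hρ01, hρs, ht⟩ := exists_finset_bump_cover (m := m)
    (U := fun x ↦ h ⁻¹' (extChartAt (𝓡 n) (h x)).source)
    fun x ↦ hh.continuousAt.preimage_mem_nhds (extChartAt_source_mem_nhds (h x))
  -- The tolerance is quantified inside the induction, since each step asks the previous map to be
  -- closer to `h`.
  have key (s : Finset M) : ∀ ε > 0, ∃ f : M → N, Continuous f ∧ (∀ x, dist (f x) (h x) < ε) ∧
      ∀ z, (∃ x ∈ s, ρ x =ᶠ[𝓝 z] 1) → ContMDiffAt (𝓡 m) (𝓡 n) ∞ f z := by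
    induction s using Finset.induction_on with
    | empty => exact fun ε hε ↦ ⟨h, hh, fun x ↦ by simpa using hε, by simp⟩
    | insert a s _ ih =>
      intro ε hε
      obtain ⟨δ, hδ, -, hstep⟩ := exists_blend_smooth hh (hρ a) (hρ01 a) (hρs a) hε
      obtain ⟨f, hf, hfh, hfs⟩ := ih δ hδ
      obtain ⟨f', hf', hfh', h1, h2⟩ := hstep f hf hfh
      refine ⟨f', hf', hfh', fun z ⟨x, hx, hz⟩ ↦ ?_⟩
      rcases Finset.mem_insert.1 hx with rfl | hx
      · exact h2 z hz
      · exact h1 z (hfs z ⟨x, hx, hz⟩)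
  obtain ⟨f, -, hfh, hf⟩ := key t ε hε
  exact ⟨f, fun z ↦ hf z (ht z), hfh⟩

/-- A functional on maps `M → N` that is invariant under straight-line variations supported where
`φ` and the varied map stay in a chart. -/
def InvariantUnderVary (m n : ℕ) {M N : Type*} [TopologicalSpace M]
    [ChartedSpace (EuclideanSpace ℝ (Fin m)) M] [TopologicalSpace N]
    [ChartedSpace (EuclideanSpace ℝ (Fin n)) N] (φ : M → N) (I : (M → N) → ℝ) : Prop :=
  ∀ (x₀ : M) (y₀ y₁ : N) (f : M → N) (V : M → EuclideanSpace ℝ (Fin n)),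
    ContMDiff (𝓡 m) (𝓡 n) ∞ f → ContMDiff (𝓡 m) 𝓘(ℝ, EuclideanSpace ℝ (Fin n)) ∞ V →
    Icc 0 1 ⊆ varyTimes f y₁ V →
    tsupport V ⊆ (extChartAt (𝓡 m) x₀).source ∩
      (f ⁻¹' (extChartAt (𝓡 n) y₁).source ∩ φ ⁻¹' (extChartAt (𝓡 n) y₀).source) →
    I (vary f y₁ V 1) = I f

/-- One smooth map is turned into the other patch by patch, each move being an admissible chart
variation that preserves `I`. The patches are small enough that both `φ` and `h` send each into a
single chart. -/
theorem InvariantUnderVary.exists_eq_of_dist_lt [IsManifold (𝓡 m) ∞ M] [IsManifold (𝓡 n) ∞ N]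
    [CompactSpace M] [T2Space M] {φ : M → N} (hφ : Continuous φ) {I : (M → N) → ℝ}
    (hI : InvariantUnderVary m n φ I) {h : M → N} (hh : Continuous h) :
    ∃ ε > 0, ∀ f f' : M → N, ContMDiff (𝓡 m) (𝓡 n) ∞ f → ContMDiff (𝓡 m) (𝓡 n) ∞ f' →
      (∀ x, dist (f x) (h x) < ε) → (∀ x, dist (f' x) (h x) < ε) → I f = I f' := by
  classical
  obtain ⟨t, ρ, hρ, hρ01, hρs, ht⟩ := exists_finset_bump_cover (m := m)
    (U := fun x ↦ ((extChartAt (𝓡 m) x).source ∩ φ ⁻¹' (extChartAt (𝓡 n) (φ x)).source) ∩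
      h ⁻¹' (extChartAt (𝓡 n) (h x)).source)
    fun x ↦ inter_mem (inter_mem (extChartAt_source_mem_nhds x)
      (hφ.continuousAt.preimage_mem_nhds (extChartAt_source_mem_nhds (φ x))))
      (hh.continuousAt.preimage_mem_nhds (extChartAt_source_mem_nhds (h x)))
  have key (s : Finset M) : ∀ ε > 0, ∃ δ > 0, ∀ f f' : M → N, ContMDiff (𝓡 m) (𝓡 n) ∞ f →
      ContMDiff (𝓡 m) (𝓡 n) ∞ f' → (∀ x, dist (f x) (h x) < δ) → (∀ x, dist (f' x) (h x) < δ) →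
      ∃ f'' : M → N, ContMDiff (𝓡 m) (𝓡 n) ∞ f'' ∧ (∀ x, dist (f'' x) (h x) < ε) ∧ I f'' = I f ∧
        ∀ z, (∃ x ∈ s, ρ x z = 1) → f'' z = f' z := by
    induction s using Finset.induction_on with
    | empty => exact fun ε hε ↦ ⟨ε, hε, fun f f' hf _ hfh _ ↦ ⟨f, hf, hfh, rfl, by simp⟩⟩
    | insert a s _ ih =>
      intro ε hε
      obtain ⟨δ₁, hδ₁, -, hstep⟩ :=
        exists_blend_toward hh (hρ a) (hρ01 a) (fun x hx ↦ (hρs a hx).2) hε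
      obtain ⟨δ₂, hδ₂, hrec⟩ := ih δ₁ hδ₁
      refine ⟨min δ₁ δ₂, lt_min hδ₁ hδ₂, fun f f' hf hf' hfh hfh' ↦ ?_⟩
      obtain ⟨f₁, hf₁, hf₁h, hIf₁, hf₁s⟩ := hrec f f' hf hf'
        (fun x ↦ (hfh x).trans_le (min_le_right _ _))
        (fun x ↦ (hfh' x).trans_le (min_le_right _ _))
      obtain ⟨V, hV, hVs, hρf, hVt, hVh, h1, h2⟩ := hstep f₁ f' hf₁ hf' hf₁h
        (fun x ↦ (hfh' x).trans_le (min_le_left _ _))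
      have hVρ : tsupport V ⊆ f₁ ⁻¹' (extChartAt (𝓡 n) (h a)).source := hVs.trans hρf
      refine ⟨vary f₁ (h a) V 1, contMDiff_vary hf₁ hV hVρ (hVt (by simp)), hVh, ?_, ?_⟩
      · rw [hI a (φ a) (h a) f₁ V hf₁ hV hVt fun x hx ↦ ⟨(hρs a (hVs hx)).1.1, hVρ hx,
          (hρs a (hVs hx)).1.2⟩, hIf₁]
      · rintro z ⟨x, hx, hz⟩
        rcases Finset.mem_insert.1 hx with rfl | hx
        · exact h2 z hz
        · exact h1 z (hf₁s z ⟨x, hx, hz⟩)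
  obtain ⟨δ, hδ, hkey⟩ := key t 1 one_pos
  refine ⟨δ, hδ, fun f f' hf hf' hfh hfh' ↦ ?_⟩
  obtain ⟨f'', -, -, hIf, heq⟩ := hkey f f' hf hf' hfh hfh'
  have : f'' = f' := funext fun z ↦ by
    obtain ⟨x, hx, hz⟩ := ht z
    exact heq z ⟨x, hx, hz.self_of_nhds⟩
  rw [← hIf, this]

/-- The stages of the homotopy are only continuous, so each is replaced by a smooth approximation `F
s`. Its value `I (F s)` is locally constant in `s`, hence constant on the connected interval. -/
theorem InvariantUnderVary.eq_of_homotopic [IsManifold (𝓡 m) ∞ M] [IsManifold (𝓡 n) ∞ N]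
    [CompactSpace M] [T2Space M] {φ : M → N} (hφ : Continuous φ) {I : (M → N) → ℝ}
    (hI : InvariantUnderVary m n φ I) {f g : C(M, N)} (hf : ContMDiff (𝓡 m) (𝓡 n) ∞ f)
    (hg : ContMDiff (𝓡 m) (𝓡 n) ∞ g) (hfg : f.Homotopic g) : I f = I g := by
  obtain ⟨H⟩ := hfg
  choose ε hε hloc using fun s : unitInterval ↦ hI.exists_eq_of_dist_lt hφ (H.curry s).continuous
  choose F hF hFH using fun s : unitInterval ↦
    exists_contMDiff_dist_lt (m := m) (n := n) (H.curry s).continuous (hε s)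
  have hlc : IsLocallyConstant fun s ↦ I (F s) := by
    refine (IsLocallyConstant.iff_eventually_eq _).2 fun s ↦ ?_
    have hc : Continuous fun r ↦ H.curry r := H.curry.continuous
    filter_upwards [hc.continuousAt.eventually (Metric.ball_mem_nhds (H.curry s)
      (half_pos (hε s)))] with r hr
    -- `F s` and `F r` approximate different stages with unrelated tolerances. The intermediate map
    -- `G` is close enough to stage `r` to be comparable with both.
    obtain ⟨G, hG, hGr⟩ := exists_contMDiff_dist_lt (m := m) (n := n) (H.curry r).continuous
      (lt_min (hε r) (half_pos (hε s)))
    rw [hloc r (F r) G (hF r) hG (hFH r) fun x ↦ (hGr x).trans_le (min_le_left _ _)]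
    refine hloc s G (F s) hG (hF s) (fun x ↦ ?_) (hFH s)
    have h1 := (hGr x).trans_le (min_le_right _ _)
    have h2 := (ContinuousMap.dist_apply_le_dist (f := H.curry r) (g := H.curry s) x).trans_lt hr
    linarith [dist_triangle (G x) (H.curry r x) (H.curry s x)]
  have h01 := hlc.apply_eq_of_preconnectedSpace 0 1
  have hend (k : C(M, N)) (hk : ContMDiff (𝓡 m) (𝓡 n) ∞ k) (s : unitInterval)
      (hs : ∀ x, H.curry s x = k x) : I (F s) = I k :=
    hloc s (F s) k (hF s) hk (hFH s) fun x ↦ by rw [hs, dist_self]; exact hε s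
  rw [← hend f hf 0 fun x ↦ H.apply_zero x, ← hend g hg 1 fun x ↦ H.apply_one x]
  exact h01

end Homotopy

end

theorem mainTheorem8 {m n : ℕ}
    {M : Type*} [TopologicalSpace M] [ChartedSpace (EuclideanSpace ℝ (Fin m)) M]
    [IsManifold (𝓡 m) ∞ M] [T2Space M] [CompactSpace M] [MeasurableSpace M] [BorelSpace M]
    [RiemannianBundle (fun x : M ↦ TangentSpace (𝓡 m) x)]
    [IsContMDiffRiemannianBundle (𝓡 m) ∞ (EuclideanSpace ℝ (Fin m))
      (fun x : M ↦ TangentSpace (𝓡 m) x)]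
    {N : Type*} [TopologicalSpace N] [ChartedSpace (EuclideanSpace ℝ (Fin n)) N]
    [IsManifold (𝓡 n) ∞ N] [T2Space N] [SecondCountableTopology N]
    (Ω : SymplecticForm n N)
    (φ : C^∞⟮𝓡 m, M; 𝓡 n, N⟯)
    (himm : ∀ x : M, Function.Injective (mfderiv (𝓡 m) (𝓡 n) φ x))
    (hcrit : IsCriticalPoint m Ω φ) :
    ∀ ψ : C^∞⟮𝓡 m, M; 𝓡 n, N⟯, ContinuousMap.Homotopic (φ : C(M, N)) (ψ : C(M, N)) →
      symplecticEnergy m Ω φ ≤ symplecticEnergy m Ω ψ := by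
  intro ψ hφψ
  -- Local compactness with the Hausdorff property gives regularity, and second countability then
  -- makes `N` metrizable; any compatible metric serves for the uniform estimates.
  have : LocallyCompactSpace N := Manifold.locallyCompact_of_finiteDimensional (𝓡 n)
  have hI : InvariantUnderVary m n φ fun f ↦
      ∫ x, formInner x (Ω.pullback m φ x) (Ω.pullback m f x) ∂(riemannianVolume m M) :=
    fun x₀ y₀ y₁ f V hf hV ht hVs ↦
      integral_formInner_vary_one Ω φ.contMDiff himm hcrit hf hV ht hVs
  have h : ∫ x, formInner x (Ω.pullback m φ x) (Ω.pullback m φ x) ∂(riemannianVolume m M) =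
      ∫ x, formInner x (Ω.pullback m φ x) (Ω.pullback m ψ x) ∂(riemannianVolume m M) := by
    let := TopologicalSpace.metrizableSpaceMetric N
    exact hI.eq_of_homotopic φ.contMDiff.continuous (f := (φ : C(M, N))) (g := (ψ : C(M, N)))
      φ.contMDiff ψ.contMDiff hφψ
  have h1 := integral_formInner_le Ω φ.contMDiff ψ.contMDiff
  have h2 := symplecticEnergy_eq (m := m) Ω φ
  linarith
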